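/- For an abelian group $A$ let $\mathsf{SP}^2(A)$ be its symmetric square and let $L_1\mathsf{SP}^2(A)$ be the first derived functor (in the sense of Dold–Puppe, at level $0$) of $\mathsf{SP}^2$, i.e. $L_1\mathsf{SP}^2(A)=\pi_1(\mathsf{SP}^2(X))$ for a simplicial resolution $X\to A$ by free abelian groups, $\mathsf{SP}^2$ being applied degreewise. Write $\mathsf{Tor}=\mathsf{Tor}_1^{\mathbb Z}$; the projection $A\otimes A\to\mathsf{SP}^2(A)$ induces on first derived functors a natural map $\mathsf{Tor}(A,A)=\pi_1(X\otimes X)\to\pi_1(\mathsf{SP}^2(X))=L_1\mathsf{SP}^2(A)$. Let $E$ be an abelian group and $I$ a subgroup of $E$. Let $\underline{\Lambda^2(I)}$ be the image of the map $\Lambda^2(I)\to\Lambda^2(E)$ induced by the inclusion, let $\Lambda^2(E)/\underline{\Lambda^2(I)}\to E/I\otimes E$ be the map induced by $x\wedge y\mapsto \bar x\otimes y-\bar y\otimes x$, and let $\mathsf{Tor}(E/I,E)\to L_1\mathsf{SP}^2(E/I)$ be the composition of the two natural maps $$\mathsf{Tor}(E/I,E)\to\mathsf{Tor}(E/I,E/I)\to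 L_1\mathsf{SP}^2(E/I).$$ Then there is an isomorphism $$\mathsf{Coker}\{\mathsf{Tor}(E/I,E)\to L_1\mathsf{SP}^2(E/I)\}\;\cong\;\mathsf{Ker}\{\Lambda^2(E)/\underline{\Lambda^2(I)}\to E/I\otimes E\},$$ natural in the pair $(E,I)$, that is, with respect to homomorphisms $f:E\to E'$ with $f(I)\subseteq I'$. -/

import Mathlib

open CategoryTheory TensorProduct Simplicial

universe u

noncomputable section

namespace QuadraticDerived

section Cech

variable {R : Type} [CommRing R]

/-! ### The Cech nerve of the canonical free cover -/

/-- The augmentation `R[A] → A` of the free module on the underlying set of `A`. -/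
def aug (A : ModuleCat.{u} R) : (A →₀ R) →ₗ[R] A :=
  Finsupp.linearCombination R (id : A → A)

theorem aug_surjective (A : ModuleCat.{u} R) : Function.Surjective (aug A) :=
  Finsupp.linearCombination_id_surjective R A

/-- The `ι`-fold fibre power of `R[A]` over `A`, as a submodule of `R[A]^ι`. -/
def fibrePowerSubmodule (A : ModuleCat.{u} R) (ι : Type) : Submodule R (ι → (A →₀ R)) where
  carrier := {x | ∀ i j, aug A (x i) = aug A (x j)}
  zero_mem' := fun i j => by simp
  add_mem' := fun {x y} hx hy i j => by
    simp only [Pi.add_apply, map_add]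
    rw [hx i j, hy i j]
  smul_mem' := fun c x hx i j => by
    simp only [Pi.smul_apply, map_smul]
    rw [hx i j]

/-- The `ι`-fold fibre power of `R[A]` over `A`. -/
def FibrePower (A : ModuleCat.{u} R) (ι : Type) : Type u := fibrePowerSubmodule A ι

namespace FibrePower

instance (A : ModuleCat.{u} R) (ι : Type) : AddCommGroup (FibrePower A ι) :=
  inferInstanceAs (AddCommGroup (fibrePowerSubmodule A ι))

instance (A : ModuleCat.{u} R) (ι : Type) : Module R (FibrePower A ι) :=
  inferInstanceAs (Module R (fibrePowerSubmodule A ι))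

/-- Constructor from the entries. -/
def mk {A : ModuleCat.{u} R} {ι : Type} (x : ι → (A →₀ R))
    (hx : ∀ i j, aug A (x i) = aug A (x j)) : FibrePower A ι :=
  Subtype.mk x hx

/-- The entries of an element of the fibre power. -/
def entry {A : ModuleCat.{u} R} {ι : Type} (i : ι) : FibrePower A ι →ₗ[R] (A →₀ R) :=
  LinearMap.proj i ∘ₗ (fibrePowerSubmodule A ι).subtype

theorem aug_entry {A : ModuleCat.{u} R} {ι : Type} (x : FibrePower A ι) (i j : ι) :
    aug A (entry i x) = aug A (entry j x) :=
  Subtype.property (p := fun x => x ∈ fibrePowerSubmodule A ι) x i j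

theorem entry_mk {A : ModuleCat.{u} R} {ι : Type} (x : ι → (A →₀ R)) (hx) (i : ι) :
    entry i (mk x hx) = x i :=
  rfl

theorem ext {A : ModuleCat.{u} R} {ι : Type} {x y : FibrePower A ι}
    (h : ∀ i, entry i x = entry i y) : x = y :=
  Subtype.ext (p := fun x => x ∈ fibrePowerSubmodule A ι) (funext h)

end FibrePower

open FibrePower (entry entry_mk aug_entry)

/-- Reindexing of fibre powers. -/
def reindex (A : ModuleCat.{u} R) {ι κ : Type} (θ : ι → κ) :
    FibrePower A κ →ₗ[R] FibrePower A ι where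
  toFun x := .mk (fun i => entry (θ i) x) fun i j => aug_entry x (θ i) (θ j)
  map_add' _ _ := rfl
  map_smul' _ _ := rfl

theorem entry_reindex (A : ModuleCat.{u} R) {ι κ : Type} (θ : ι → κ) (x : FibrePower A κ)
    (i : ι) : entry i (reindex A θ x) = entry (θ i) x :=
  rfl

theorem aug_mapDomain {A B : ModuleCat.{u} R} (f : A ⟶ B) (x : A →₀ R) :
    aug B (Finsupp.lmapDomain R R f x) = f (aug A x) := by
  induction x using Finsupp.induction_linear with
  | zero => simp
  | add x y hx hy => simp only [map_add, hx, hy]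
  | single a n => simp [aug]

/-- Functoriality of the fibre power in the module. -/
def fibrePowerMap {A B : ModuleCat.{u} R} (f : A ⟶ B) (ι : Type) :
    FibrePower A ι →ₗ[R] FibrePower B ι where
  toFun x := .mk (fun i => Finsupp.lmapDomain R R f (entry i x)) fun i j => by
    rw [aug_mapDomain, aug_mapDomain, aug_entry x i j]
  map_add' x y := FibrePower.ext fun i => by simp only [entry_mk, map_add]
  map_smul' c x := FibrePower.ext fun i => by
    simp only [entry_mk, map_smul, RingHom.id_apply]

/-- The Cech nerve of `R[A] → A`: the simplicial module `n ↦ R[A] ×_A ⋯ ×_A R[A]`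
(`n + 1` factors), whose faces omit and whose degeneracies repeat entries. It is functorial
in `A`. -/
def cechNerve : ModuleCat.{u} R ⥤ SimplicialObject (ModuleCat.{u} R) where
  obj A :=
    { obj := fun Δ => ModuleCat.of R (FibrePower A (Fin (Δ.unop.len + 1)))
      map := fun θ => ModuleCat.ofHom (reindex A θ.unop.toOrderHom)
      map_id := fun _ => rfl
      map_comp := fun _ _ => rfl }
  map f :=
    { app := fun Δ => ModuleCat.ofHom (fibrePowerMap f (Fin (Δ.unop.len + 1)))
      naturality := by intros; rfl }
  map_id A := by
    apply NatTrans.ext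
    funext Δ
    apply ModuleCat.hom_ext
    refine LinearMap.ext fun x => FibrePower.ext fun i => ?_
    exact Finsupp.mapDomain_id
  map_comp f g := by
    apply NatTrans.ext
    funext Δ
    apply ModuleCat.hom_ext
    refine LinearMap.ext fun x => FibrePower.ext fun i => ?_
    exact Finsupp.mapDomain_comp (f := f) (g := g)

/-- The augmentation of the `n`-th term of the Cech nerve. -/
def cechAug (A : ModuleCat.{u} R) (n : ℕ) : FibrePower A (Fin (n + 1)) →ₗ[R] A :=
  aug A ∘ₗ entry 0

theorem cechAug_reindex (A : ModuleCat.{u} R) {n m : ℕ} (θ : Fin (n + 1) → Fin (m + 1))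
    (x : FibrePower A (Fin (m + 1))) : cechAug A n (reindex A θ x) = cechAug A m x :=
  aug_entry x _ _

/-- The alternating face map complex of the Cech nerve. -/
abbrev cechComplex (A : ModuleCat.{u} R) : ChainComplex (ModuleCat.{u} R) ℕ :=
  (AlgebraicTopology.alternatingFaceMapComplex _).obj (cechNerve.obj A)

/-- The alternating sum of the faces of the Cech nerve. -/
def cechD (A : ModuleCat.{u} R) (n : ℕ) :
    FibrePower A (Fin (n + 2)) →ₗ[R] FibrePower A (Fin (n + 1)) :=
  ∑ i : Fin (n + 2), (-1 : ℤ) ^ (i : ℕ) • reindex A i.succAbove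

theorem cechComplex_d (A : ModuleCat.{u} R) (n : ℕ) :
    (cechComplex A).d (n + 1) n = ModuleCat.ofHom (cechD A n) := by
  rw [AlgebraicTopology.alternatingFaceMapComplex_obj_d]
  apply ModuleCat.hom_ext
  simp only [AlgebraicTopology.AlternatingFaceMapComplex.objD, ModuleCat.hom_sum,
    ModuleCat.hom_zsmul]
  rfl

theorem cechD_apply (A : ModuleCat.{u} R) (n : ℕ) (x : FibrePower A (Fin (n + 2)))
    (k : Fin (n + 1)) :
    entry k (cechD A n x) = ∑ i : Fin (n + 2), (-1 : ℤ) ^ (i : ℕ) • entry (i.succAbove k) x := by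
  simp [cechD, entry_reindex]

theorem cechAug_comp_cechD (A : ModuleCat.{u} R) : cechAug A 0 ∘ₗ cechD A 0 = 0 := by
  refine LinearMap.ext fun x => ?_
  simp [cechD, Fin.sum_univ_succ, cechAug_reindex]

/-- The augmentation `cechComplex A → A`. -/
def cechπ (A : ModuleCat.{u} R) : cechComplex A ⟶ (ChainComplex.single₀ _).obj A :=
  (ChainComplex.toSingle₀Equiv _ _).symm ⟨ModuleCat.ofHom (cechAug A 0), by
    rw [cechComplex_d]
    exact ModuleCat.hom_ext (cechAug_comp_cechD A)⟩

/-- Prepending an entry to an element of a fibre power. -/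
def fibreCons (A : ModuleCat.{u} R) {n : ℕ} (c : A →₀ R) (x : FibrePower A (Fin (n + 1)))
    (h : aug A c = cechAug A n x) : FibrePower A (Fin (n + 2)) :=
  .mk (Fin.cons c fun i => entry i x) (by
    have key : ∀ i, aug A (Fin.cons (α := fun _ => A →₀ R) c (fun i => entry i x) i) =
        cechAug A n x := by
      refine Fin.cases ?_ fun i => ?_
      · simpa using h
      · rw [Fin.cons_succ]
        exact aug_entry x i 0
    exact fun i j => (key i).trans (key j).symm)

theorem entry_fibreCons (A : ModuleCat.{u} R) {n : ℕ} (c : A →₀ R)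
    (x : FibrePower A (Fin (n + 1))) (h : aug A c = cechAug A n x) (i : Fin (n + 2)) :
    entry i (fibreCons A c x h) = Fin.cons (α := fun _ => A →₀ R) c (fun i => entry i x) i :=
  rfl

theorem cech_exact_succ (A : ModuleCat.{u} R) (n : ℕ) (x : FibrePower A (Fin (n + 2)))
    (hx : cechD A n x = 0) : ∃ y : FibrePower A (Fin (n + 3)), cechD A (n + 1) y = x := by
  have hx' : ∀ k, ∑ i : Fin (n + 2), (-1 : ℤ) ^ (i : ℕ) • entry (i.succAbove k) x = 0 := by
    intro k
    rw [← cechD_apply, hx, map_zero]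
  obtain ⟨c, hc, hc'⟩ : ∃ c, aug A c = cechAug A (n + 1) x ∧
      ∑ i : Fin (n + 2), (-1 : ℤ) ^ (i : ℕ) • c = 0 := by
    by_cases hn : Even n
    · refine ⟨entry 0 x, rfl, ?_⟩
      rw [← Finset.sum_smul, Fin.sum_neg_one_pow, if_pos (by simpa [Nat.even_add] using hn),
        zero_smul]
    · refine ⟨0, ?_, by simp⟩
      have h := congrArg (aug A) (hx' 0)
      simp only [map_sum, map_zsmul, map_zero] at h
      rw [Finset.sum_congr rfl fun i _ => by rw [aug_entry x (i.succAbove 0) 0],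
        ← Finset.sum_smul, Fin.sum_neg_one_pow,
        if_neg (by simpa [Nat.even_add] using hn), one_smul] at h
      rw [map_zero]
      exact h.symm
  refine ⟨fibreCons A c x hc, FibrePower.ext fun k => ?_⟩
  rw [cechD_apply, Fin.sum_univ_succ]
  have hz : ∑ i : Fin (n + 2), (-1 : ℤ) ^ (i.succ : ℕ) •
      entry (i.succ.succAbove k) (fibreCons A c x hc) = 0 := by
    refine Fin.cases ?_ (fun k => ?_) k
    · simpa [entry_fibreCons, pow_succ] using hc'
    · simpa [entry_fibreCons, pow_succ] using hx' k
  rw [hz]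
  simp [entry_fibreCons]

theorem cech_exact_zero (A : ModuleCat.{u} R) (x : FibrePower A (Fin 1))
    (hx : cechAug A 0 x = 0) : ∃ y : FibrePower A (Fin 2), cechD A 0 y = x := by
  refine ⟨fibreCons A 0 x (by rw [map_zero, hx]), FibrePower.ext fun k => ?_⟩
  rw [cechD_apply, Fin.sum_univ_two]
  fin_cases k
  simp [entry_fibreCons]

theorem cechAug_surjective (A : ModuleCat.{u} R) (n : ℕ) :
    Function.Surjective (cechAug A n) := by
  intro a
  obtain ⟨q, rfl⟩ := aug_surjective A a
  exact ⟨.mk (fun _ => q) fun _ _ => rfl, rfl⟩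

theorem quasiIso_cechπ (A : ModuleCat.{u} R) : QuasiIso (cechπ A) where
  quasiIsoAt m := by
    cases m with
    | zero =>
      rw [ChainComplex.quasiIsoAt₀_iff, ShortComplex.quasiIso_iff_of_zeros' _ ?_ rfl rfl]
      rotate_left
      · exact (cechComplex A).shape 0 0 (by simp)
      constructor
      · rw [ShortComplex.moduleCat_exact_iff]
        intro x hx
        obtain ⟨y, hy⟩ := cech_exact_zero A x (by
          simpa [cechπ] using! hx)
        refine ⟨y, ?_⟩
        change (cechComplex A).d 1 0 y = x
        rw [cechComplex_d]
        exact hy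
      · rw [ModuleCat.epi_iff_surjective]
        intro a
        obtain ⟨x, hx⟩ := cechAug_surjective A 0 a
        exact ⟨x, by simpa [cechπ] using! hx⟩
    | succ m =>
      rw [quasiIsoAt_iff_exactAt' (hL := ChainComplex.exactAt_succ_single_obj ..),
        HomologicalComplex.exactAt_iff' _ (m + 2) (m + 1) m (by simp) (by simp),
        ShortComplex.moduleCat_exact_iff]
      intro x hx
      obtain ⟨y, hy⟩ := cech_exact_succ A m x (by
        change (cechComplex A).d (m + 1) m x = 0 at hx
        rw [cechComplex_d] at hx
        exact hx)
      refine ⟨y, ?_⟩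
      change (cechComplex A).d (m + 2) (m + 1) y = x
      rw [cechComplex_d]
      exact hy

end Cech

section Sym

variable {R : Type} [CommRing R] {M N : Type u} [AddCommGroup M] [AddCommGroup N] [Module R M]
  [Module R N]

/-! ### The symmetric square -/

/-- Linear maps out of `Sym[R]^2 M` from symmetric multilinear maps. -/
def symLift (f : MultilinearMap R (fun _ : Fin 2 => M) N)
    (hf : ∀ (e : Equiv.Perm (Fin 2)) (v : Fin 2 → M), f (fun i => v (e i)) = f v) :
    Sym[R]^2 M →ₗ[R] N where
  toFun := AddCon.lift (addConGen (SymmetricPower.Rel R (Fin 2) M))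
    (PiTensorProduct.lift f : (⨂[R] _ : Fin 2, M) →+ N) (AddCon.addConGen_le.2 (by
      rintro _ _ ⟨e, v⟩
      simp [hf]))
  map_add' x y := map_add _ x y
  map_smul' c x := AddCon.induction_on x fun x => (PiTensorProduct.lift f).map_smul c x

theorem symLift_tprod (f : MultilinearMap R (fun _ : Fin 2 => M) N)
    (hf : ∀ (e : Equiv.Perm (Fin 2)) (v : Fin 2 → M), f (fun i => v (e i)) = f v)
    (v : Fin 2 → M) : symLift f hf (SymmetricPower.tprod R v) = f v :=
  PiTensorProduct.lift.tprod v

theorem sym_hom_ext {f g : Sym[R]^2 M →ₗ[R] N}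
    (h : ∀ v : Fin 2 → M, f (SymmetricPower.tprod R v) = g (SymmetricPower.tprod R v)) :
    f = g := by
  refine LinearMap.ext_on (SymmetricPower.span_tprod_eq_top R (Fin 2) M) ?_
  rintro _ ⟨v, rfl⟩
  exact h v

/-- The map induced on symmetric squares by a linear map. -/
def symMap (f : M →ₗ[R] N) : Sym[R]^2 M →ₗ[R] Sym[R]^2 N :=
  symLift ((SymmetricPower.tprod R).compLinearMap fun _ => f) fun e v =>
    SymmetricPower.tprod_equiv e fun i => f (v i)

theorem symMap_tprod (f : M →ₗ[R] N) (v : Fin 2 → M) :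
    symMap f (SymmetricPower.tprod R v) = SymmetricPower.tprod R fun i => f (v i) :=
  symLift_tprod _ _ v

variable (R) in
/-- The product `ab` in `SP²(M)`. -/
def symMul (a b : M) : Sym[R]^2 M :=
  SymmetricPower.tprod (M := M) (ι := Fin 2) R ![a, b]

theorem update_zero {M : Type u} (a b c : M) : Function.update ![a, b] 0 c = ![c, b] := by
  funext i
  fin_cases i <;> rfl

theorem update_one {M : Type u} (a b c : M) : Function.update ![a, b] 1 c = ![a, c] := by
  funext i
  fin_cases i <;> rfl

variable (R M) in
/-- The canonical projection `M ⊗ M → SP²(M)`, `a ⊗ b ↦ ab`. -/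
def tensorToSym : M ⊗[R] M →ₗ[R] Sym[R]^2 M :=
  TensorProduct.lift (LinearMap.mk₂ R (symMul R)
    (fun a a' b => by
      have h := (SymmetricPower.tprod (M := M) (ι := Fin 2) R).map_update_add ![a, b] 0 a a'
      simp only [update_zero] at h
      exact h)
    (fun c a b => by
      have h := (SymmetricPower.tprod (M := M) (ι := Fin 2) R).map_update_smul ![a, b] 0 c a
      simp only [update_zero] at h
      exact h)
    (fun a b b' => by
      have h := (SymmetricPower.tprod (M := M) (ι := Fin 2) R).map_update_add ![a, b] 1 b b'
      simp only [update_one] at h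
      exact h)
    (fun c a b => by
      have h := (SymmetricPower.tprod (M := M) (ι := Fin 2) R).map_update_smul ![a, b] 1 c b
      simp only [update_one] at h
      exact h))

theorem tensorToSym_tmul (a b : M) : tensorToSym R M (a ⊗ₜ b) = symMul R a b :=
  rfl

theorem tensorToSym_naturality (f : M →ₗ[R] N) :
    tensorToSym R N ∘ₗ TensorProduct.map f f = symMap f ∘ₗ tensorToSym R M := by
  apply TensorProduct.ext'
  intro a b
  rw [LinearMap.comp_apply, LinearMap.comp_apply, TensorProduct.map_tmul, tensorToSym_tmul,
    tensorToSym_tmul, symMul, symMul, symMap_tprod]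
  congr 1
  funext i
  fin_cases i <;> rfl

variable (R) in
/-- The symmetric square functor `SP²`. -/
def SP2 : ModuleCat.{u} R ⥤ ModuleCat.{u} R where
  obj A := ModuleCat.of R (Sym[R]^2 A)
  map f := ModuleCat.ofHom (symMap f.hom)
  map_id A := ModuleCat.hom_ext (sym_hom_ext fun v => symMap_tprod _ v)
  map_comp f g := ModuleCat.hom_ext (sym_hom_ext fun v => by
    simp [symMap_tprod])

end Sym

section Tensor

variable {R : Type} [CommRing R]

/-- The functor `A ⊗ -`. -/
def tensorFunctor (A : ModuleCat.{u} R) : ModuleCat.{u} R ⥤ ModuleCat.{u} R where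
  obj B := ModuleCat.of R (A ⊗[R] B)
  map f := ModuleCat.ofHom (f.hom.lTensor A)
  map_id B := ModuleCat.hom_ext (LinearMap.lTensor_id A B)
  map_comp f g := ModuleCat.hom_ext (LinearMap.lTensor_comp A g.hom f.hom)

instance (A : ModuleCat.{u} R) : (tensorFunctor A).Additive where
  map_add {_ _ f g} := ModuleCat.hom_ext (LinearMap.lTensor_add A f.hom g.hom)

/-- The degreewise tensor product of simplicial modules. -/
def degreewiseTensor (X Y : SimplicialObject (ModuleCat.{u} R)) :
    SimplicialObject (ModuleCat.{u} R) where
  obj Δ := ModuleCat.of R (X.obj Δ ⊗[R] Y.obj Δ)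
  map θ := ModuleCat.ofHom (TensorProduct.map (X.map θ).hom (Y.map θ).hom)
  map_id Δ := by
    apply ModuleCat.hom_ext
    simp
  map_comp θ η := by
    apply ModuleCat.hom_ext
    simp [TensorProduct.map_comp]

/-- The projection of simplicial modules `X ⊗ X → SP²(X)`, where `SP²` is applied degreewise. -/
def degreewiseTensorToSym (X : SimplicialObject (ModuleCat.{u} R)) :
    degreewiseTensor X X ⟶ ((SimplicialObject.whiskering _ _).obj (SP2 R)).obj X where
  app Δ := ModuleCat.ofHom (tensorToSym R (X.obj Δ))
  naturality _ _ θ := ModuleCat.hom_ext (tensorToSym_naturality (X.map θ).hom)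

/-- The chain complex of the simplicial module `X(A) ⊗ X(B)`, where `X` is the Cech nerve. -/
abbrev tensorComplex (A B : ModuleCat.{u} R) : ChainComplex (ModuleCat.{u} R) ℕ :=
  (AlgebraicTopology.alternatingFaceMapComplex _).obj
    (degreewiseTensor (cechNerve.obj A) (cechNerve.obj B))

/-- The alternating sum of the faces of `X(A) ⊗ X(B)`. -/
def tensorD (A B : ModuleCat.{u} R) (n : ℕ) :
    FibrePower A (Fin (n + 2)) ⊗[R] FibrePower B (Fin (n + 2)) →ₗ[R]
      FibrePower A (Fin (n + 1)) ⊗[R] FibrePower B (Fin (n + 1)) :=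
  ∑ i : Fin (n + 2), (-1 : ℤ) ^ (i : ℕ) •
    TensorProduct.map (reindex A i.succAbove) (reindex B i.succAbove)

theorem tensorComplex_d (A B : ModuleCat.{u} R) (n : ℕ) :
    (tensorComplex A B).d (n + 1) n = ModuleCat.ofHom (tensorD A B n) := by
  rw [AlgebraicTopology.alternatingFaceMapComplex_obj_d]
  apply ModuleCat.hom_ext
  simp only [AlgebraicTopology.AlternatingFaceMapComplex.objD, ModuleCat.hom_sum,
    ModuleCat.hom_zsmul]
  rfl

/-- The degree `n` part of the map `X(A) ⊗ X(B) → A ⊗ X(B)`. -/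
def augT (A B : ModuleCat.{u} R) (n : ℕ) :
    FibrePower A (Fin (n + 1)) ⊗[R] FibrePower B (Fin (n + 1)) →ₗ[R]
      A ⊗[R] FibrePower B (Fin (n + 1)) :=
  (cechAug A n).rTensor (FibrePower B (Fin (n + 1)))

theorem augT_comm (A B : ModuleCat.{u} R) (n : ℕ) :
    (cechD B n).lTensor A ∘ₗ augT A B (n + 1) = augT A B n ∘ₗ tensorD A B n := by
  apply TensorProduct.ext'
  intro x y
  simp [augT, tensorD, cechD, cechAug_reindex, TensorProduct.tmul_sum, map_sum]

/-- The chain map `X(A) ⊗ X(B) → A ⊗ X(B)` induced by the augmentation `X(A) → A`. -/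
def augTensor (A B : ModuleCat.{u} R) :
    tensorComplex A B ⟶ ((tensorFunctor A).mapHomologicalComplex _).obj (cechComplex B) where
  f n := ModuleCat.ofHom (augT A B n)
  comm' := by
    rintro _ n rfl
    rw [tensorComplex_d, Functor.mapHomologicalComplex_obj_d, cechComplex_d]
    exact ModuleCat.hom_ext (augT_comm A B n)

/-- An element-wise criterion for a chain map to induce an isomorphism on `H₁`. -/
theorem isIso_homologyMap_one {K L : ChainComplex (ModuleCat.{u} R) ℕ} (f : K ⟶ L)
    (hinj : ∀ x : K.X 1, K.d 1 0 x = 0 → ∀ y : L.X 2, L.d 2 1 y = f.f 1 x →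
      ∃ w : K.X 2, K.d 2 1 w = x)
    (hsurj : ∀ z : L.X 1, L.d 1 0 z = 0 → ∃ x : K.X 1, K.d 1 0 x = 0 ∧ f.f 1 x = z) :
    IsIso (HomologicalComplex.homologyMap f 1) := by
  have lift : ∀ (C : ChainComplex (ModuleCat.{u} R) ℕ) (z : C.X 1), C.d 1 0 z = 0 →
      ∃ c : C.cycles 1, C.iCycles 1 c = z := by
    intro C z hz
    have := (ShortComplex.moduleCat_exact_iff _).1
      (ShortComplex.exact_of_f_is_kernel
        (ShortComplex.mk (C.iCycles 1) (C.d 1 0) (C.iCycles_d 1 0))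
        (C.cyclesIsKernel 1 0 (by simp))) z hz
    exact this
  have bd : ∀ (C : ChainComplex (ModuleCat.{u} R) ℕ) (c : C.cycles 1), C.homologyπ 1 c = 0 →
      ∃ w : C.X 2, C.toCycles 2 1 w = c := by
    intro C c hc
    exact (ShortComplex.moduleCat_exact_iff _).1
      (ShortComplex.exact_of_g_is_cokernel
        (ShortComplex.mk (C.toCycles 2 1) (C.homologyπ 1) (C.toCycles_comp_homologyπ 2 1))
        (C.homologyIsCokernel 2 1 (by simp))) c hc
  have surj : ∀ (C : ChainComplex (ModuleCat.{u} R) ℕ), Function.Surjective (C.homologyπ 1) :=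
    fun C => (ModuleCat.epi_iff_surjective _).1 inferInstance
  have inj : ∀ (C : ChainComplex (ModuleCat.{u} R) ℕ), Function.Injective (C.iCycles 1) :=
    fun C => (ModuleCat.mono_iff_injective _).1 inferInstance
  have nat : ∀ c : K.cycles 1, HomologicalComplex.homologyMap f 1 (K.homologyπ 1 c) =
      L.homologyπ 1 (HomologicalComplex.cyclesMap f 1 c) := fun c =>
    ConcreteCategory.congr_hom (HomologicalComplex.homologyπ_naturality f 1) c
  have nat' : ∀ c : K.cycles 1, L.iCycles 1 (HomologicalComplex.cyclesMap f 1 c) =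
      f.f 1 (K.iCycles 1 c) := fun c =>
    ConcreteCategory.congr_hom (HomologicalComplex.cyclesMap_i f 1) c
  have dcyc : ∀ (C : ChainComplex (ModuleCat.{u} R) ℕ) (w : C.X 2),
      C.iCycles 1 (C.toCycles 2 1 w) = C.d 2 1 w := fun C w =>
    ConcreteCategory.congr_hom (C.toCycles_i 2 1) w
  rw [ConcreteCategory.isIso_iff_bijective]
  constructor
  · rw [injective_iff_map_eq_zero]
    intro h hh
    obtain ⟨c, rfl⟩ := surj K h
    rw [nat] at hh
    obtain ⟨y, hy⟩ := bd L _ hh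
    obtain ⟨w, hw⟩ := hinj (K.iCycles 1 c)
      (ConcreteCategory.congr_hom (K.iCycles_d 1 0) c) y (by rw [← nat', ← hy, dcyc])
    have : K.toCycles 2 1 w = c := inj K (by rw [dcyc, hw])
    rw [← this]
    exact ConcreteCategory.congr_hom (K.toCycles_comp_homologyπ 2 1) w
  · intro h
    obtain ⟨c, rfl⟩ := surj L h
    obtain ⟨x, hx, hx'⟩ := hsurj (L.iCycles 1 c) (ConcreteCategory.congr_hom (L.iCycles_d 1 0) c)
    obtain ⟨k, hk⟩ := lift K x hx
    refine ⟨K.homologyπ 1 k, ?_⟩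
    rw [nat]
    congr 1
    apply inj L
    rw [nat', hk, hx']

/-- The kernel of the augmentation of the Cech nerve in degree `n`. -/
abbrev cechKer (A : ModuleCat.{u} R) (n : ℕ) : Submodule R (FibrePower A (Fin (n + 1))) :=
  LinearMap.ker (cechAug A n)

theorem cech_tensor_exact (A : ModuleCat.{u} R) (n : ℕ) (Y : Type u) [AddCommGroup Y]
    [Module R Y] :
    Function.Exact ((cechKer A n).subtype.rTensor Y) ((cechAug A n).rTensor Y) :=
  rTensor_exact Y (LinearMap.exact_subtype_ker_map (cechAug A n)) (cechAug_surjective A n)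

/-- `X_n(A) ⊗ X_n(B)` (with `k = n + 1`). -/
abbrev XX (A B : ModuleCat.{u} R) (k : ℕ) : Type u :=
  FibrePower A (Fin k) ⊗[R] FibrePower B (Fin k)

/-- `Z_0 ⊗ X_0(B)`, where `Z` is the kernel of `X(A) → A`. -/
abbrev ZX0 (A B : ModuleCat.{u} R) : Type u := cechKer A 0 ⊗[R] FibrePower B (Fin 1)

/-- `Z_1 ⊗ X_1(B)`, where `Z` is the kernel of `X(A) → A`. -/
abbrev ZX1 (A B : ModuleCat.{u} R) : Type u := cechKer A 1 ⊗[R] FibrePower B (Fin 2)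

/-- The differential of `X(A) ⊗ X(B)` in degree `1`. -/
def D0 (A B : ModuleCat.{u} R) : XX A B 2 →ₗ[R] XX A B 1 := tensorD A B 0

/-- The differential of `X(A) ⊗ X(B)` in degree `2`. -/
def D1 (A B : ModuleCat.{u} R) : XX A B 3 →ₗ[R] XX A B 2 := tensorD A B 1

theorem D0_tmul (A B : ModuleCat.{u} R) (x : FibrePower A (Fin 2)) (y : FibrePower B (Fin 2)) :
    D0 A B (x ⊗ₜ y) = reindex A ![1] x ⊗ₜ reindex B ![1] y -
      reindex A ![0] x ⊗ₜ reindex B ![0] y := by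
  have e0 : Fin.succAbove (n := 1) 0 = ![1] := by decide
  have e1 : Fin.succAbove (n := 1) 1 = ![0] := by decide
  change tensorD A B 0 (x ⊗ₜ y) = _
  rw [tensorD, Fin.sum_univ_two, e0, e1]
  simp [sub_eq_add_neg]

theorem D1_tmul (A B : ModuleCat.{u} R) (x : FibrePower A (Fin 3)) (y : FibrePower B (Fin 3)) :
    D1 A B (x ⊗ₜ y) = reindex A ![1, 2] x ⊗ₜ reindex B ![1, 2] y -
      reindex A ![0, 2] x ⊗ₜ reindex B ![0, 2] y +
      reindex A ![0, 1] x ⊗ₜ reindex B ![0, 1] y := by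
  have e0 : Fin.succAbove (n := 2) 0 = ![1, 2] := by decide
  have e1 : Fin.succAbove (n := 2) 1 = ![0, 2] := by decide
  have e2 : Fin.succAbove (n := 2) 2 = ![0, 1] := by decide
  change tensorD A B 1 (x ⊗ₜ y) = _
  rw [tensorD, Fin.sum_univ_three, e0, e1, e2]
  simp [sub_eq_add_neg]

/-- The extra degeneracy on the kernel of the augmentation in degree `0`, prepending a zero. -/
def extraDeg0 (A : ModuleCat.{u} R) : cechKer A 0 →ₗ[R] FibrePower A (Fin 2) where
  toFun x := fibreCons A 0 x.1 (by rw [map_zero, LinearMap.mem_ker.1 x.2])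
  map_add' x y := FibrePower.ext fun i => by
    refine Fin.cases ?_ (fun i => ?_) i <;> simp [entry_fibreCons]
  map_smul' c x := FibrePower.ext fun i => by
    refine Fin.cases ?_ (fun i => ?_) i <;> simp [entry_fibreCons]

/-- The extra degeneracy on the kernel of the augmentation in degree `1`, prepending a zero. -/
def extraDeg1 (A : ModuleCat.{u} R) : cechKer A 1 →ₗ[R] FibrePower A (Fin 3) where
  toFun x := fibreCons A 0 x.1 (by rw [map_zero, LinearMap.mem_ker.1 x.2])
  map_add' x y := FibrePower.ext fun i => by
    refine Fin.cases ?_ (fun i => ?_) i <;> simp [entry_fibreCons]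
  map_smul' c x := FibrePower.ext fun i => by
    refine Fin.cases ?_ (fun i => ?_) i <;> simp [entry_fibreCons]

/-- A face map on the kernel of the augmentation. -/
def kerFace (A : ModuleCat.{u} R) (θ : Fin 1 → Fin 2) : cechKer A 1 →ₗ[R] cechKer A 0 :=
  (reindex A θ ∘ₗ (cechKer A 1).subtype).codRestrict _ fun x => by
    rw [LinearMap.mem_ker]
    exact (cechAug_reindex A θ x.1).trans x.2

/-- The inclusion `Z_0 ⊗ X_0(B) → X_0(A) ⊗ X_0(B)`. -/
def incl0 (A B : ModuleCat.{u} R) : ZX0 A B →ₗ[R] XX A B 1 :=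
  (cechKer A 0).subtype.rTensor _

/-- The inclusion `Z_1 ⊗ X_1(B) → X_1(A) ⊗ X_1(B)`. -/
def incl1 (A B : ModuleCat.{u} R) : ZX1 A B →ₗ[R] XX A B 2 :=
  (cechKer A 1).subtype.rTensor _

/-- The contracting homotopy in degree `0`. -/
def hty0 (A B : ModuleCat.{u} R) : ZX0 A B →ₗ[R] XX A B 2 :=
  TensorProduct.map (extraDeg0 A) (reindex B ![0, 0])

/-- The first part of the contracting homotopy in degree `1`. -/
def hty1a (A B : ModuleCat.{u} R) : ZX1 A B →ₗ[R] XX A B 3 :=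
  TensorProduct.map (extraDeg1 A) (reindex B ![0, 0, 1])

/-- The second part of the contracting homotopy in degree `1`. -/
def hty1b (A B : ModuleCat.{u} R) : ZX1 A B →ₗ[R] XX A B 3 :=
  TensorProduct.map (reindex A ![0, 0, 2] ∘ₗ extraDeg1 A) (reindex B ![0, 1, 1])

/-- The two faces of `Z ⊗ X(B)` in degree `1`. -/
def kerFaceT (A B : ModuleCat.{u} R) (θ : Fin 1 → Fin 2) : ZX1 A B →ₗ[R] ZX0 A B :=
  TensorProduct.map (kerFace A θ) (reindex B θ)

/-- The differential `Z_1 ⊗ X_1(B) → Z_0 ⊗ X_0(B)`. -/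
def kerD (A B : ModuleCat.{u} R) : ZX1 A B →ₗ[R] ZX0 A B :=
  kerFaceT A B ![1] - kerFaceT A B ![0]

theorem D0_hty0 (A B : ModuleCat.{u} R) : D0 A B ∘ₗ hty0 A B = incl0 A B := by
  apply TensorProduct.ext'
  intro x y
  have h0 : reindex A ![1] (extraDeg0 A x) = x.1 := by
    refine FibrePower.ext fun i => ?_
    fin_cases i
    rfl
  have h1 : reindex A ![0] (extraDeg0 A x) = 0 := by
    refine FibrePower.ext fun i => ?_
    fin_cases i
    rfl
  have e0 : reindex B ![1] (reindex B ![0, 0] y) = y := by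
    refine FibrePower.ext fun i => ?_
    fin_cases i
    rfl
  change D0 A B (extraDeg0 A x ⊗ₜ reindex B ![0, 0] y) = x.1 ⊗ₜ y
  rw [D0_tmul, h0, h1, e0, TensorProduct.zero_tmul, sub_zero]

theorem incl0_kerD (A B : ModuleCat.{u} R) : incl0 A B ∘ₗ kerD A B = D0 A B ∘ₗ incl1 A B := by
  apply TensorProduct.ext'
  intro x y
  change incl0 A B (kerFace A ![1] x ⊗ₜ reindex B ![1] y -
    kerFace A ![0] x ⊗ₜ reindex B ![0] y) = D0 A B (x.1 ⊗ₜ y)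
  rw [D0_tmul, map_sub]
  rfl

theorem D1_hty1 (A B : ModuleCat.{u} R) :
    D1 A B ∘ₗ (hty1a A B - hty1b A B) = incl1 A B - hty0 A B ∘ₗ kerD A B := by
  apply TensorProduct.ext'
  intro x y
  have a0 : reindex A ![1, 2] (extraDeg1 A x) = x.1 := by
    refine FibrePower.ext fun i => ?_
    fin_cases i <;> rfl
  have a1 : reindex A ![0, 2] (extraDeg1 A x) = extraDeg0 A (kerFace A ![1] x) := by
    refine FibrePower.ext fun i => ?_
    fin_cases i <;> rfl
  have a2 : reindex A ![0, 1] (extraDeg1 A x) = extraDeg0 A (kerFace A ![0] x) := by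
    refine FibrePower.ext fun i => ?_
    fin_cases i <;> rfl
  have b0 : reindex A ![1, 2] (reindex A ![0, 0, 2] (extraDeg1 A x)) =
      extraDeg0 A (kerFace A ![1] x) := by
    refine FibrePower.ext fun i => ?_
    fin_cases i <;> rfl
  have b1 : reindex A ![0, 2] (reindex A ![0, 0, 2] (extraDeg1 A x)) =
      extraDeg0 A (kerFace A ![1] x) := by
    refine FibrePower.ext fun i => ?_
    fin_cases i <;> rfl
  have b2 : reindex A ![0, 1] (reindex A ![0, 0, 2] (extraDeg1 A x)) = 0 := by
    refine FibrePower.ext fun i => ?_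
    fin_cases i <;> rfl
  have c0 : reindex B ![1, 2] (reindex B ![0, 0, 1] y) = y := by
    refine FibrePower.ext fun i => ?_
    fin_cases i <;> rfl
  have c1 : reindex B ![0, 2] (reindex B ![0, 0, 1] y) = y := by
    refine FibrePower.ext fun i => ?_
    fin_cases i <;> rfl
  have c2 : reindex B ![0, 1] (reindex B ![0, 0, 1] y) =
      reindex B ![0, 0] (reindex B ![0] y) := by
    refine FibrePower.ext fun i => ?_
    fin_cases i <;> rfl
  have d0 : reindex B ![1, 2] (reindex B ![0, 1, 1] y) =
      reindex B ![0, 0] (reindex B ![1] y) := by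
    refine FibrePower.ext fun i => ?_
    fin_cases i <;> rfl
  have d1 : reindex B ![0, 2] (reindex B ![0, 1, 1] y) = y := by
    refine FibrePower.ext fun i => ?_
    fin_cases i <;> rfl
  change D1 A B (extraDeg1 A x ⊗ₜ reindex B ![0, 0, 1] y -
      reindex A ![0, 0, 2] (extraDeg1 A x) ⊗ₜ reindex B ![0, 1, 1] y) =
    x.1 ⊗ₜ y - hty0 A B (kerFace A ![1] x ⊗ₜ reindex B ![1] y -
      kerFace A ![0] x ⊗ₜ reindex B ![0] y)
  rw [map_sub, map_sub, D1_tmul, D1_tmul, a0, a1, a2, b0, b1, b2, c0, c1, c2, d0, d1,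
    TensorProduct.zero_tmul]
  change _ = x.1 ⊗ₜ y - (extraDeg0 A (kerFace A ![1] x) ⊗ₜ reindex B ![0, 0] (reindex B ![1] y) -
    extraDeg0 A (kerFace A ![0] x) ⊗ₜ reindex B ![0, 0] (reindex B ![0] y))
  abel

theorem augT_hty0 (A B : ModuleCat.{u} R) : augT A B 1 ∘ₗ hty0 A B = 0 := by
  apply TensorProduct.ext'
  intro x y
  have : cechAug A 1 (extraDeg0 A x) = 0 := map_zero (aug A)
  change cechAug A 1 (extraDeg0 A x) ⊗ₜ[R] reindex B ![0, 0] y = 0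
  rw [this, TensorProduct.zero_tmul]

theorem incl0_injective (A B : ModuleCat.{u} R) : Function.Injective (incl0 A B) := by
  let e : FibrePower B (Fin 1) ≃ₗ[R] (B →₀ R) :=
    { FibrePower.entry (A := B) (0 : Fin 1) with
      invFun := fun q => .mk (fun _ => q) fun _ _ => rfl
      left_inv := fun x => FibrePower.ext fun i => by
        fin_cases i
        rfl
      right_inv := fun _ => rfl }
  have : Module.Flat R (FibrePower B (Fin 1)) := Module.Flat.of_linearEquiv e
  exact Module.Flat.rTensor_preserves_injective_linearMap _ (Submodule.subtype_injective _)

theorem augT_surjective (A B : ModuleCat.{u} R) (n : ℕ) : Function.Surjective (augT A B n) :=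
  LinearMap.rTensor_surjective _ (cechAug_surjective A n)

theorem face_face (A : ModuleCat.{u} R) (i : Fin 2) (θ : Fin 2 → Fin 3)
    (x : FibrePower A (Fin 3)) : reindex A ![i] (reindex A θ x) = reindex A ![θ i] x := by
  refine FibrePower.ext fun j => ?_
  fin_cases j
  rfl

theorem D0_D1 (A B : ModuleCat.{u} R) (x : XX A B 3) : D0 A B (D1 A B x) = 0 := by
  have : D0 A B ∘ₗ D1 A B = 0 := by
    apply TensorProduct.ext'
    intro x y
    rw [LinearMap.comp_apply, D1_tmul, map_add, map_sub, D0_tmul, D0_tmul, D0_tmul]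
    simp only [face_face]
    simp
  exact LinearMap.congr_fun this x

theorem aug_surj_on_cycles (A B : ModuleCat.{u} R) (z : A ⊗[R] FibrePower B (Fin 2))
    (hz : (cechD B 0).lTensor A z = 0) : ∃ x : XX A B 2, D0 A B x = 0 ∧ augT A B 1 x = z := by
  obtain ⟨Z, rfl⟩ := augT_surjective A B 1 z
  have hZ : augT A B 0 (D0 A B Z) = 0 := by
    rw [← hz]
    exact (LinearMap.congr_fun (augT_comm A B 0) Z).symm
  have hex := cech_tensor_exact A 0 (FibrePower B (Fin 1))
  obtain ⟨w, hw⟩ : ∃ w, incl0 A B w = D0 A B Z := (hex _).1 hZ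
  have h0 : D0 A B (hty0 A B w) = D0 A B Z :=
    (LinearMap.congr_fun (D0_hty0 A B) w).trans hw
  have h1 : augT A B 1 (hty0 A B w) = 0 := LinearMap.congr_fun (augT_hty0 A B) w
  let Z' : XX A B 2 := Z
  refine ⟨Z' - hty0 A B w, ?_, ?_⟩
  · rw [map_sub, h0, sub_self]
  · have := map_sub (augT A B 1) Z' (hty0 A B w)
    exact this.trans (by rw [h1, sub_zero])

theorem aug_inj_on_homology (A B : ModuleCat.{u} R) (x : XX A B 2) (hx : D0 A B x = 0)
    (y : A ⊗[R] FibrePower B (Fin 3)) (hy : (cechD B 1).lTensor A y = augT A B 1 x) :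
    ∃ w : XX A B 3, D1 A B w = x := by
  obtain ⟨Y, rfl⟩ := augT_surjective A B 2 y
  let Y' : XX A B 3 := Y
  have hY : augT A B 1 (x - D1 A B Y') = 0 := by
    have h := map_sub (augT A B 1) x (D1 A B Y')
    refine h.trans ?_
    rw [← hy, sub_eq_zero]
    exact LinearMap.congr_fun (augT_comm A B 1) Y
  have hex := cech_tensor_exact A 1 (FibrePower B (Fin 2))
  obtain ⟨w, hw'⟩ : ∃ w, incl1 A B w = x - D1 A B Y' := (hex _).1 hY
  have h0 : kerD A B w = 0 := incl0_injective A B (by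
    rw [map_zero]
    refine (LinearMap.congr_fun (incl0_kerD A B) w).trans ?_
    rw [LinearMap.comp_apply, hw', map_sub, hx, D0_D1, sub_zero])
  have h1 := LinearMap.congr_fun (D1_hty1 A B) w
  rw [LinearMap.comp_apply, LinearMap.sub_apply (incl1 A B), LinearMap.comp_apply, h0, map_zero,
    sub_zero, hw'] at h1
  exact ⟨(hty1a A B - hty1b A B) w + Y', by rw [map_add, h1, sub_add_cancel]⟩

/-- The map `X(A) ⊗ X(B) → A ⊗ X(B)` is an isomorphism on `H₁`. -/
theorem isIso_homologyMap_augTensor (A B : ModuleCat.{u} R) :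
    IsIso (HomologicalComplex.homologyMap (augTensor A B) 1) := by
  apply isIso_homologyMap_one
  · intro x hx y hy
    rw [tensorComplex_d] at hx
    rw [Functor.mapHomologicalComplex_obj_d, cechComplex_d] at hy
    obtain ⟨w, hw⟩ := aug_inj_on_homology A B x hx y hy
    refine ⟨w, ?_⟩
    rw [tensorComplex_d]
    exact hw
  · intro z hz
    rw [Functor.mapHomologicalComplex_obj_d, cechComplex_d] at hz
    obtain ⟨x, hx, hx'⟩ := aug_surj_on_cycles A B z hz
    refine ⟨x, ?_, hx'⟩
    rw [tensorComplex_d]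
    exact hx

end Tensor

/-- A subgroup of a projective abelian group is projective. -/
theorem projective_submodule {F : Type u} [AddCommGroup F] [Module ℤ F] [Module.Projective ℤ F]
    (P : Submodule ℤ F) : Module.Projective ℤ P := by
  refine Module.Projective.of_lifting_property'' fun f hf => ?_
  let J := P →₀ ℚ
  let j : (P →₀ ℤ) →ₗ[ℤ] J :=
    Finsupp.mapRange.linearMap (Int.castAddHom ℚ).toIntLinearMap
  have hj : Function.Injective j :=
    Finsupp.mapRange_injective (Int.castAddHom ℚ) (map_zero _) Int.cast_injective
  let K : Submodule ℤ J := (LinearMap.ker f).map j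
  let _ : DivisibleBy J ℤ :=
    { div := fun x n => (n : ℚ)⁻¹ • x
      div_zero := fun x => by simp
      div_cancel := fun {n} x hn => by
        have hn' : (n : ℚ) ≠ 0 := Int.cast_ne_zero.2 hn
        rw [← Int.cast_smul_eq_zsmul ℚ, smul_smul, mul_inv_cancel₀ hn', one_smul] }
  let _ : DivisibleBy (J ⧸ K) ℤ := Function.Surjective.divisibleBy K.mkQ.toAddMonoidHom
    K.mkQ_surjective (fun a n => map_zsmul K.mkQ.toAddMonoidHom n a)
  let g : P →+ J ⧸ K :=
    ((LinearMap.ker f).mapQ K j (Submodule.le_comap_map _ _)).toAddMonoidHom.comp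
      (f.quotKerEquivOfSurjective hf).symm.toAddEquiv.toAddMonoidHom
  have hg : ∀ m, g (f m) = K.mkQ (j m) := by
    intro m
    have : (f.quotKerEquivOfSurjective hf).symm (f m) = (LinearMap.ker f).mkQ m := by
      rw [LinearEquiv.symm_apply_eq]
      rfl
    change (LinearMap.ker f).mapQ K j (Submodule.le_comap_map _ _)
      ((f.quotKerEquivOfSurjective hf).symm (f m)) = _
    rw [this]
    rfl
  obtain ⟨e₀, he⟩ := (Module.Baer.of_divisible (J ⧸ K)).extension_property_addMonoidHom
    P.subtype.toAddMonoidHom P.subtype_injective g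
  let e : F →ₗ[ℤ] J ⧸ K :=
    { toFun := e₀
      map_add' := map_add e₀
      map_smul' := fun c x => by
        rw [RingHom.id_apply, ← map_zsmul e₀]
        congr 1
        exact (int_smul_eq_zsmul _ c x) }
  obtain ⟨l, hl⟩ := Module.projective_lifting_property K.mkQ e K.mkQ_surjective
  have key : ∀ p : P, ∃ m, j m = l p ∧ f m = p := by
    intro p
    obtain ⟨m, rfl⟩ := hf p
    have h1 : K.mkQ (l (f m)) = K.mkQ (j m) := by
      rw [← hg, ← he]
      exact LinearMap.congr_fun hl _
    have h2 : l (f m) - j m ∈ K := by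
      rw [← Submodule.ker_mkQ K, LinearMap.mem_ker, map_sub, h1, sub_self]
    obtain ⟨k, hk, hk'⟩ := h2
    refine ⟨m + k, ?_, ?_⟩
    · rw [map_add, hk']
      abel
    · rw [map_add, LinearMap.mem_ker.1 hk, add_zero]
  choose s hs hs' using key
  refine ⟨⟨⟨s, fun x y => hj ?_⟩, fun c x => hj ?_⟩, LinearMap.ext hs'⟩
  · rw [map_add, hs, hs, hs]
    simp
  · simp only [RingHom.id_apply]
    rw [map_smul, hs, hs]
    simp

/-! ### Derived functors -/

instance (A : ModuleCat.{u} ℤ) (ι : Type) [Finite ι] : Module.Projective ℤ (FibrePower A ι) :=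
  projective_submodule (fibrePowerSubmodule A ι)

/-- The Cech nerve of `ℤ[A] → A` is a simplicial projective resolution of the abelian group `A`. -/
def cechResolution (A : ModuleCat.{u} ℤ) : ProjectiveResolution A where
  complex := cechComplex A
  projective n := inferInstanceAs
    (Projective (ModuleCat.of ℤ (FibrePower A (Fin (n + 1)))))
  π := cechπ A
  quasiIso := quasiIso_cechπ A

/-- The derived functors `L_n T` (at level `0`) of a not necessarily additive functor `T` of abelian
groups: apply `T` degreewise to a simplicial projective resolution, here the functorial one given
by `cechNerve`, and take the `n`-th homology group of the resulting simplicial abelian group. -/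
def derivedFunctor (T : ModuleCat.{u} ℤ ⥤ ModuleCat.{u} ℤ) (n : ℕ) :
    ModuleCat.{u} ℤ ⥤ ModuleCat.{u} ℤ :=
  cechNerve ⋙ (SimplicialObject.whiskering _ _).obj T ⋙
    AlgebraicTopology.alternatingFaceMapComplex _ ⋙ HomologicalComplex.homologyFunctor _ _ n

/-- The functor `L₁SP²`. -/
def L1SP2 : ModuleCat.{u} ℤ ⥤ ModuleCat.{u} ℤ := derivedFunctor (SP2 ℤ) 1

/-- `Tor(A, -) = Tor₁^ℤ(A, -)`, the first left derived functor of `A ⊗ -`. -/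
def tor (A : ModuleCat.{u} ℤ) : ModuleCat.{u} ℤ ⥤ ModuleCat.{u} ℤ :=
  (tensorFunctor A).leftDerived 1

/-- The canonical isomorphism `H₁(X(A) ⊗ X(B)) ≅ Tor(A, B)`, where `X` is the simplicial
resolution: the augmentation `X(A) ⊗ X(B) → A ⊗ X(B)` is an isomorphism on `H₁`, and
`Tor(A, B)` is the first homology group of `A ⊗ X(B)`. -/
def torIso (A B : ModuleCat.{u} ℤ) : (tensorComplex A B).homology 1 ≅ (tor A).obj B :=
  haveI := isIso_homologyMap_augTensor A B
  asIso (HomologicalComplex.homologyMap (augTensor A B) 1) ≪≫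
    ((cechResolution B).isoLeftDerivedObj (tensorFunctor A) 1).symm

/-- The natural map `Tor(A, A) → L₁SP²(A)`, induced by the projection `⊗² → SP²` and the
identification of `Tor(A, A)` with the first derived functor `H₁(X(A) ⊗ X(A))` of `⊗²`. -/
def torToL1SP2 (A : ModuleCat.{u} ℤ) : (tor A).obj A ⟶ L1SP2.obj A :=
  (torIso A A).inv ≫ HomologicalComplex.homologyMap
    ((AlgebraicTopology.alternatingFaceMapComplex _).map
      (degreewiseTensorToSym (cechNerve.obj A))) 1

/-! ### The map from the exterior square -/

section Wedge

variable {R : Type} [CommRing R] {I E Q I' E' : Type u} [AddCommGroup I] [AddCommGroup E]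
  [AddCommGroup Q] [AddCommGroup I'] [AddCommGroup E'] [Module R I] [Module R E] [Module R Q]
  [Module R I'] [Module R E']

variable (R E) in
/-- The alternating map `(x, y) ↦ x ⊗ y - y ⊗ x`. -/
def antisymmetrizer : E [⋀^Fin 2]→ₗ[R] (E ⊗[R] E) where
  toFun v := v 0 ⊗ₜ v 1 - v 1 ⊗ₜ v 0
  map_update_add' v i x y := by
    fin_cases i <;> simp [TensorProduct.add_tmul, TensorProduct.tmul_add] <;> abel
  map_update_smul' v i c x := by
    fin_cases i <;> simp [TensorProduct.smul_tmul', smul_sub]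
  map_eq_zero_of_eq' v i j h hij := by
    have : v 0 = v 1 := by
      fin_cases i <;> fin_cases j <;> simp_all
    rw [this, sub_self]

variable (R E) in
/-- The map `Λ²(E) → E ⊗ E`, `x ∧ y ↦ x ⊗ y - y ⊗ x`. -/
def wedgeToTensor : ⋀[R]^2 E →ₗ[R] E ⊗[R] E :=
  exteriorPower.alternatingMapLinearEquiv (antisymmetrizer R E)

theorem wedgeToTensor_ιMulti (v : Fin 2 → E) :
    wedgeToTensor R E (exteriorPower.ιMulti R 2 v) = v 0 ⊗ₜ v 1 - v 1 ⊗ₜ v 0 :=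
  exteriorPower.alternatingMapLinearEquiv_apply_ιMulti _ _

/-- For `j : I → E`, the quotient of `Λ²(E)` by the image of `Λ²(I)`. -/
abbrev WedgeQuot (j : I →ₗ[R] E) : Type u :=
  (⋀[R]^2 E) ⧸ LinearMap.range (exteriorPower.map 2 j)

/-- For `p : E → Q` vanishing on `I`, the map `Λ²(E)/Λ²(I) → Q ⊗ E` induced by
`Λ²(E) → E ⊗ E → Q ⊗ E`. -/
def wedgeQuotToTensor (j : I →ₗ[R] E) (p : E →ₗ[R] Q) (h : p ∘ₗ j = 0) :
    WedgeQuot j →ₗ[R] Q ⊗[R] E :=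
  Submodule.liftQ _ (p.rTensor E ∘ₗ wedgeToTensor R E) (by
    rw [LinearMap.range_le_ker_iff]
    apply exteriorPower.linearMap_ext
    ext v
    have h' : ∀ x, p (j x) = 0 := LinearMap.congr_fun h
    simp [wedgeToTensor_ιMulti, h'])

/-- The kernel of `Λ²(E)/Λ²(I) → Q ⊗ E`. -/
def wedgeQuotKer (j : I →ₗ[R] E) (p : E →ₗ[R] Q) (h : p ∘ₗ j = 0) : Submodule R (WedgeQuot j) :=
  LinearMap.ker (wedgeQuotToTensor j p h)

/-- The map induced on the quotients `Λ²(E)/Λ²(I)` by a commutative square. -/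
def wedgeQuotMap {j : I →ₗ[R] E} {j' : I' →ₗ[R] E'} (g : I →ₗ[R] I') (f : E →ₗ[R] E')
    (h : f ∘ₗ j = j' ∘ₗ g) : WedgeQuot j →ₗ[R] WedgeQuot j' :=
  Submodule.mapQ _ _ (exteriorPower.map 2 f) (by
    rintro _ ⟨x, rfl⟩
    refine ⟨exteriorPower.map 2 g x, ?_⟩
    have h' := exteriorPower.map_comp (n := 2) g j'
    rw [← h, exteriorPower.map_comp] at h'
    exact (LinearMap.congr_fun h' x).symm)

end Wedge

/-! ### The two groups -/

section Groups

variable {E E' : Type u} [AddCommGroup E] [AddCommGroup E']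

/-- The projection `E → E/I`. -/
def proj (I : AddSubgroup E) : E →ₗ[ℤ] E ⧸ I := (QuotientAddGroup.mk' I).toIntLinearMap

/-- The inclusion `I → E`. -/
def incl (I : AddSubgroup E) : I →ₗ[ℤ] E := I.subtype.toIntLinearMap

/-- The composition `Tor(E/I, E) → Tor(E/I, E/I) → L₁SP²(E/I)`. -/
def torMap (I : AddSubgroup E) :
    (tor (ModuleCat.of ℤ (E ⧸ I))).obj (ModuleCat.of ℤ E) ⟶ L1SP2.obj (ModuleCat.of ℤ (E ⧸ I)) :=
  (tor (ModuleCat.of ℤ (E ⧸ I))).map (ModuleCat.ofHom (proj I)) ≫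
    torToL1SP2 (ModuleCat.of ℤ (E ⧸ I))

/-- The cokernel of `Tor(E/I, E) → L₁SP²(E/I)`. -/
abbrev TorCoker (I : AddSubgroup E) : Type u :=
  L1SP2.obj (ModuleCat.of ℤ (E ⧸ I)) ⧸ LinearMap.range (torMap I).hom

/-- The projection `L₁SP²(E/I) → Coker (Tor(E/I, E) → L₁SP²(E/I))`. -/
abbrev toTorCoker (I : AddSubgroup E) : L1SP2.obj (ModuleCat.of ℤ (E ⧸ I)) →+ TorCoker I :=
  (LinearMap.range (torMap I).hom).mkQ.toAddMonoidHom

/-- The kernel of `Λ²(E)/image(Λ²(I)) → E/I ⊗ E`, where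
`x ∧ y` is mapped to `x̄ ⊗ y - ȳ ⊗ x`. -/
abbrev WedgeKer (I : AddSubgroup E) :=
  wedgeQuotKer (incl I) (proj I)
    (LinearMap.ext fun x => (QuotientAddGroup.eq_zero_iff (x : E)).2 x.2)

/-- A homomorphism `f : E → E'` with `f(I) ⊆ I'` induces a map `L₁SP²(E/I) → L₁SP²(E'/I')`. -/
def L1SP2Map {I : AddSubgroup E} {I' : AddSubgroup E'} (f : E →+ E') (hf : I ≤ I'.comap f) :
    L1SP2.obj (ModuleCat.of ℤ (E ⧸ I)) ⟶ L1SP2.obj (ModuleCat.of ℤ (E' ⧸ I')) :=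
  L1SP2.map (ModuleCat.ofHom (QuotientAddGroup.map I I' f hf).toIntLinearMap)

/-- A homomorphism `f : E → E'` with `f(I) ⊆ I'` induces a map
`Λ²(E)/image(Λ²(I)) → Λ²(E')/image(Λ²(I'))`. -/
def wedgeMap {I : AddSubgroup E} {I' : AddSubgroup E'} (f : E →+ E') (hf : I ≤ I'.comap f) :
    WedgeQuot (incl I) →+ WedgeQuot (incl I') :=
  (wedgeQuotMap (j := incl I) (j' := incl I')
    (((f.comp I.subtype).codRestrict I' fun x => hf x.2).toIntLinearMap)
    f.toIntLinearMap rfl).toAddMonoidHom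

end Groups

end QuadraticDerived

end

/-!
Write `A = E/I`, let `R[A]` be the free module on the set `A`, `K` the kernel of `R[A] → A`, and `X`
the Cech nerve of `R[A] → A`. For a pair `I → E` let `W(E, I)` be the kernel of
`Λ²(E)/Λ²(I) → E/I ⊗ E`.

*The case of the free presentation.* The map `xy ↦ (x₁ - x₀) ⊗ y₁ + (y₁ - y₀) ⊗ x₀` (`symKoszul`)
compares `SP²(X)` in low degrees with the Koszul complex `Λ²(K) → K ⊗ R[A] → SP²(R[A])`. Explicit
degenerate simplices show that it is injective modulo boundaries
(`mem_range_symD_of_symKoszul_eq_zero`) and maps the `1`-cycles onto the kernel of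
`(K ⊗ R[A])/Λ²(K) → SP²(R[A])`. As `R[A]` is free, the antisymmetrization `Λ²(R[A]) → R[A] ⊗ R[A]`
is injective and identifies this kernel with `W(R[A], K)`. So `H₁(SP²(X)) ≅ W(R[A], K)`
(`homologyToWedge`).

*Homotopy invariance.* Two maps of pairs `(E, I) → (E', I')` that agree modulo `I'` induce the same
map `W(E, I) → W(E', I')` (`wedgeInduced_eq_of_sub_mem`). Hence any lift `R[A] → E` of the
augmentation induces one and the same map `W(R[A], K) → W(E, I)`, which is therefore natural in the
pair `(E, I)`.

*Kernel and image.* Let `J` be the preimage of `I` in `R[E]` and `N` the kernel of `R[E] → E`. A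
diagram chase shows that `W(R[E], J) → W(E, I)` is surjective and that its kernel consists of the
sums of elements `x ∧ n` with `n ∈ N` that die in `A ⊗ R[E]`, that is, of the image of
`Tor(A, E) = Ker (A ⊗ N → A ⊗ R[E])` (`wedgeInduced_surjective_on_ker`, `ker_wedgeInduced_le`). By
homotopy invariance `W(R[E], J) ≅ W(R[A], K)`. It remains to compare this with the map
`Tor(A, E) → L₁SP²(A)`: its image consists of the classes of the images of `1`-cycles `∑ x ⊗ y` of
`X(A) ⊗ X(E)`, and such a cycle corresponds to `∑ π(y₁ - y₀) ∧ x₀`, where `π : R[E] → R[A]`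
(`wedgeToKoszul_tensorCycle`, `mem_range_tor_iff`, `wedgeInduced_coverLift_eq_zero_iff`).
-/

noncomputable section

namespace QuadraticDerived

section Factor

variable {R M N P : Type*} [CommRing R] [AddCommGroup M] [AddCommGroup N] [AddCommGroup P]
  [Module R M] [Module R N] [Module R P]

/-- The factorisation of `g` through a surjection `f` with `ker f ≤ ker g`. -/
def factorThrough (f : M →ₗ[R] N) (hf : Function.Surjective f) (g : M →ₗ[R] P)
    (h : LinearMap.ker f ≤ LinearMap.ker g) : N →ₗ[R] P :=
  (LinearMap.ker f).liftQ g h ∘ₗ (f.quotKerEquivOfSurjective hf).symm.toLinearMap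

theorem factorThrough_apply (f : M →ₗ[R] N) (hf : Function.Surjective f) (g : M →ₗ[R] P)
    (h : LinearMap.ker f ≤ LinearMap.ker g) (x : M) : factorThrough f hf g h (f x) = g x := by
  have : (f.quotKerEquivOfSurjective hf).symm (f x) = (LinearMap.ker f).mkQ x := by
    rw [LinearEquiv.symm_apply_eq]
    rfl
  simp only [factorThrough, LinearMap.comp_apply, LinearEquiv.coe_coe, this]
  rfl

/-- The first isomorphism theorem, for given descriptions of the kernel and the image. -/
def quotEquivOfKerRange (f : M →ₗ[R] N) {K : Submodule R M} {S : Submodule R N}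
    (hK : LinearMap.ker f = K) (hS : LinearMap.range f = S) : (M ⧸ K) ≃+ S :=
  ((Submodule.quotEquivOfEq _ _ hK.symm).trans
    (f.quotKerEquivRange.trans (LinearEquiv.ofEq _ _ hS))).toAddEquiv

theorem quotEquivOfKerRange_mkQ (f : M →ₗ[R] N) {K : Submodule R M} {S : Submodule R N}
    (hK : LinearMap.ker f = K) (hS : LinearMap.range f = S) (x : M) :
    (quotEquivOfKerRange f hK hS (K.mkQ x) : N) = f x :=
  rfl

end Factor

section Kernel

variable {R : Type} {M N : Type u} [CommRing R] [AddCommGroup M] [AddCommGroup N] [Module R M]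
  [Module R N]

/-- The kernel of a linear map, as a type with its own module structure. -/
def KerType (f : M →ₗ[R] N) : Type u := LinearMap.ker f

instance (f : M →ₗ[R] N) : AddCommGroup (KerType f) :=
  inferInstanceAs (AddCommGroup (LinearMap.ker f))

instance (f : M →ₗ[R] N) : Module R (KerType f) :=
  inferInstanceAs (Module R (LinearMap.ker f))

/-- The inclusion of the kernel of a linear map. -/
def kerIncl (f : M →ₗ[R] N) : KerType f →ₗ[R] M := (LinearMap.ker f).subtype

theorem kerIncl_injective (f : M →ₗ[R] N) : Function.Injective (kerIncl f) :=
  Submodule.subtype_injective _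

theorem kerIncl_exact (f : M →ₗ[R] N) : Function.Exact (kerIncl f) f :=
  LinearMap.exact_subtype_ker_map f

end Kernel

section WedgeQuot

variable {R : Type} [CommRing R] {I E Q I' E' Q' I'' E'' N Y : Type u} [AddCommGroup I]
  [AddCommGroup E] [AddCommGroup I''] [AddCommGroup E''] [AddCommGroup N] [Module R I'']
  [Module R E''] [Module R N]
  [AddCommGroup Q] [AddCommGroup I'] [AddCommGroup E'] [AddCommGroup Q'] [AddCommGroup Y]
  [Module R I] [Module R E] [Module R Q] [Module R I'] [Module R E'] [Module R Q'] [Module R Y]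

/-! ### The quotient of the exterior square -/

/-- The alternating map on two variables defined by a linear map out of `E ⊗ E` that vanishes on
the diagonal. -/
def altOfTensor (B : E ⊗[R] E →ₗ[R] Y) (hB : ∀ x, B (x ⊗ₜ x) = 0) : E [⋀^Fin 2]→ₗ[R] Y where
  toFun v := B (v 0 ⊗ₜ v 1)
  map_update_add' v i x y := by
    fin_cases i <;> simp [TensorProduct.add_tmul, TensorProduct.tmul_add]
  map_update_smul' v i c x := by
    fin_cases i <;> simp [← TensorProduct.smul_tmul', map_smul]
  map_eq_zero_of_eq' v i j h hij := by
    have : v 0 = v 1 := by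
      fin_cases i <;> fin_cases j <;> simp_all
    rw [this, hB]

/-- The surjection `E ⊗ E → Λ²(E)/Λ²(I)`, `x ⊗ y ↦ x ∧ y`. -/
def tensorToWedge (j : I →ₗ[R] E) : E ⊗[R] E →ₗ[R] WedgeQuot j :=
  (LinearMap.range (exteriorPower.map 2 j)).mkQ ∘ₗ
  TensorProduct.lift (LinearMap.mk₂ R (fun x y => exteriorPower.ιMulti R 2 ![x, y])
    (fun a a' b => by
      have h := (exteriorPower.ιMulti R 2 (M := E)).map_update_add ![a, b] 0 a a'
      simpa only [update_zero] using h)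
    (fun c a b => by
      have h := (exteriorPower.ιMulti R 2 (M := E)).map_update_smul ![a, b] 0 c a
      simpa only [update_zero] using h)
    (fun a b b' => by
      have h := (exteriorPower.ιMulti R 2 (M := E)).map_update_add ![a, b] 1 b b'
      simpa only [update_one] using h)
    (fun c a b => by
      have h := (exteriorPower.ιMulti R 2 (M := E)).map_update_smul ![a, b] 1 c b
      simpa only [update_one] using h))

theorem mkQ_ιMulti (j : I →ₗ[R] E) (v : Fin 2 → E) :
    (LinearMap.range (exteriorPower.map 2 j)).mkQ (exteriorPower.ιMulti R 2 v) =
      tensorToWedge j (v 0 ⊗ₜ v 1) := by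
  have : v = ![v 0, v 1] := by
    funext i
    fin_cases i <;> rfl
  conv_lhs => rw [this]
  rfl

theorem tensorToWedge_surjective (j : I →ₗ[R] E) : Function.Surjective (tensorToWedge j) := by
  intro w
  obtain ⟨w, rfl⟩ := Submodule.mkQ_surjective _ w
  have h : ⊤ ≤ (LinearMap.range (tensorToWedge j)).comap
      (LinearMap.range (exteriorPower.map 2 j)).mkQ := by
    rw [← exteriorPower.ιMulti_span, Submodule.span_le]
    rintro _ ⟨v, rfl⟩
    exact ⟨v 0 ⊗ₜ v 1, (mkQ_ιMulti j v).symm⟩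
  exact h Submodule.mem_top

theorem wedgeQuot_hom_ext (j : I →ₗ[R] E) {f g : WedgeQuot j →ₗ[R] Y}
    (h : ∀ x y, f (tensorToWedge j (x ⊗ₜ y)) = g (tensorToWedge j (x ⊗ₜ y))) : f = g := by
  rw [← LinearMap.cancel_right (tensorToWedge_surjective j)]
  exact TensorProduct.ext' h

theorem tensorToWedge_self (j : I →ₗ[R] E) (x : E) : tensorToWedge j (x ⊗ₜ x) = 0 := by
  refine (mkQ_ιMulti j ![x, x]).symm.trans ?_
  rw [(exteriorPower.ιMulti R 2).map_eq_zero_of_eq ![x, x]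
    (i := 0) (j := 1) rfl (by decide), map_zero]

theorem tensorToWedge_swap (j : I →ₗ[R] E) (x y : E) :
    tensorToWedge j (y ⊗ₜ x) = -tensorToWedge j (x ⊗ₜ y) := by
  have h := tensorToWedge_self j (x + y)
  rw [TensorProduct.add_tmul, TensorProduct.tmul_add, TensorProduct.tmul_add, map_add, map_add,
    map_add, tensorToWedge_self, tensorToWedge_self, zero_add, add_zero] at h
  exact eq_neg_of_add_eq_zero_right h

theorem tensorToWedge_of_mem (j : I →ₗ[R] E) {x y : E} (hx : x ∈ LinearMap.range j)
    (hy : y ∈ LinearMap.range j) : tensorToWedge j (x ⊗ₜ y) = 0 := by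
  obtain ⟨a, rfl⟩ := hx
  obtain ⟨b, rfl⟩ := hy
  refine (mkQ_ιMulti j ![j a, j b]).symm.trans ?_
  rw [← LinearMap.mem_ker, Submodule.ker_mkQ]
  refine ⟨exteriorPower.ιMulti R 2 ![a, b], ?_⟩
  rw [exteriorPower.map_apply_ιMulti]
  congr 1
  funext i
  fin_cases i <;> rfl

/-- The universal property of `Λ²(E)/Λ²(I)`. -/
def wedgeLift (j : I →ₗ[R] E) (B : E ⊗[R] E →ₗ[R] Y) (hB : ∀ x, B (x ⊗ₜ x) = 0)
    (hj : ∀ a b, B (j a ⊗ₜ j b) = 0) : WedgeQuot j →ₗ[R] Y :=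
  Submodule.liftQ _ (exteriorPower.alternatingMapLinearEquiv (altOfTensor B hB)) (by
    rw [LinearMap.range_le_ker_iff]
    apply exteriorPower.linearMap_ext
    ext v
    simpa [altOfTensor] using hj (v 0) (v 1))

theorem wedgeLift_apply (j : I →ₗ[R] E) (B : E ⊗[R] E →ₗ[R] Y) (hB : ∀ x, B (x ⊗ₜ x) = 0)
    (hj : ∀ a b, B (j a ⊗ₜ j b) = 0) (t : E ⊗[R] E) :
    wedgeLift j B hB hj (tensorToWedge j t) = B t := by
  have : wedgeLift j B hB hj ∘ₗ tensorToWedge j = B := by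
    apply TensorProduct.ext'
    intro x y
    rw [LinearMap.comp_apply]
    change wedgeLift j B hB hj (tensorToWedge j (![x, y] 0 ⊗ₜ ![x, y] 1)) = _
    rw [← mkQ_ιMulti, Submodule.mkQ_apply, wedgeLift, Submodule.liftQ_apply,
      exteriorPower.alternatingMapLinearEquiv_apply_ιMulti]
    rfl
  exact LinearMap.congr_fun this t

theorem wedgeQuotToTensor_apply (j : I →ₗ[R] E) (p : E →ₗ[R] Q) (h : p ∘ₗ j = 0) (x y : E) :
    wedgeQuotToTensor j p h (tensorToWedge j (x ⊗ₜ y)) = p x ⊗ₜ y - p y ⊗ₜ x := by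
  change wedgeQuotToTensor j p h (tensorToWedge j (![x, y] 0 ⊗ₜ ![x, y] 1)) = _
  rw [← mkQ_ιMulti, Submodule.mkQ_apply, wedgeQuotToTensor, Submodule.liftQ_apply,
    LinearMap.comp_apply, wedgeToTensor_ιMulti]
  simp

/-- The map `Λ²(E)/Λ²(I) → Λ²(E')/Λ²(I')` induced by a map `φ : E → E'` that sends the image
of `I` into the image of `I'`. -/
def wedgeInduced (j : I →ₗ[R] E) (j' : I' →ₗ[R] E') (φ : E →ₗ[R] E')
    (hφ : ∀ a, φ (j a) ∈ LinearMap.range j') : WedgeQuot j →ₗ[R] WedgeQuot j' :=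
  wedgeLift j (tensorToWedge j' ∘ₗ TensorProduct.map φ φ)
    (fun x => tensorToWedge_self j' (φ x))
    (fun a b => tensorToWedge_of_mem j' (hφ a) (hφ b))

theorem wedgeInduced_apply (j : I →ₗ[R] E) (j' : I' →ₗ[R] E') (φ : E →ₗ[R] E')
    (hφ : ∀ a, φ (j a) ∈ LinearMap.range j') (t : E ⊗[R] E) :
    wedgeInduced j j' φ hφ (tensorToWedge j t) = tensorToWedge j' (TensorProduct.map φ φ t) :=
  wedgeLift_apply j _ _ _ t

theorem wedgeQuotMap_apply {j : I →ₗ[R] E} {j' : I' →ₗ[R] E'} (g : I →ₗ[R] I') (f : E →ₗ[R] E')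
    (h : f ∘ₗ j = j' ∘ₗ g) (t : E ⊗[R] E) :
    wedgeQuotMap g f h (tensorToWedge j t) = tensorToWedge j' (TensorProduct.map f f t) := by
  have : wedgeQuotMap g f h ∘ₗ tensorToWedge j =
      tensorToWedge j' ∘ₗ TensorProduct.map f f := by
    apply TensorProduct.ext'
    intro x y
    change wedgeQuotMap g f h (tensorToWedge j (![x, y] 0 ⊗ₜ ![x, y] 1)) =
      tensorToWedge j' (f (![x, y] 0) ⊗ₜ f (![x, y] 1))
    rw [← mkQ_ιMulti, Submodule.mkQ_apply, wedgeQuotMap, Submodule.mapQ_apply,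
      exteriorPower.map_apply_ιMulti]
    exact mkQ_ιMulti j' _
  exact LinearMap.congr_fun this t

theorem wedgeInduced_comp (j : I →ₗ[R] E) (j' : I' →ₗ[R] E') (j'' : I'' →ₗ[R] E'')
    (φ : E →ₗ[R] E') (hφ : ∀ a, φ (j a) ∈ LinearMap.range j') (ψ : E' →ₗ[R] E'')
    (hψ : ∀ a, ψ (j' a) ∈ LinearMap.range j'')
    (hc : ∀ a, (ψ ∘ₗ φ) (j a) ∈ LinearMap.range j'') (k : WedgeQuot j) :
    wedgeInduced j' j'' ψ hψ (wedgeInduced j j' φ hφ k) =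
      wedgeInduced j j'' (ψ ∘ₗ φ) hc k := by
  obtain ⟨t, rfl⟩ := tensorToWedge_surjective j k
  rw [wedgeInduced_apply, wedgeInduced_apply, wedgeInduced_apply, TensorProduct.map_comp]
  rfl

theorem wedgeInduced_id (j : I →ₗ[R] E) (h : ∀ a, (LinearMap.id : E →ₗ[R] E) (j a) ∈
    LinearMap.range j) (k : WedgeQuot j) : wedgeInduced j j .id h k = k := by
  obtain ⟨t, rfl⟩ := tensorToWedge_surjective j k
  rw [wedgeInduced_apply, TensorProduct.map_id, LinearMap.id_apply]

theorem wedgeQuotMap_eq_wedgeInduced {j : I →ₗ[R] E} {j' : I' →ₗ[R] E'} (g : I →ₗ[R] I')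
    (f : E →ₗ[R] E') (h : f ∘ₗ j = j' ∘ₗ g) (hf : ∀ a, f (j a) ∈ LinearMap.range j')
    (k : WedgeQuot j) : wedgeQuotMap g f h k = wedgeInduced j j' f hf k := by
  obtain ⟨t, rfl⟩ := tensorToWedge_surjective j k
  rw [wedgeInduced_apply, wedgeQuotMap_apply]

/-- Naturality of the map `Λ²(E)/Λ²(I) → E/I ⊗ E`. -/
theorem wedgeQuotToTensor_wedgeInduced (j : I →ₗ[R] E) (p : E →ₗ[R] Q) (h : p ∘ₗ j = 0)
    (j' : I' →ₗ[R] E') (p' : E' →ₗ[R] Q') (h' : p' ∘ₗ j' = 0) (φ : E →ₗ[R] E')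
    (hφ : ∀ a, φ (j a) ∈ LinearMap.range j') (q : Q →ₗ[R] Q') (hq : ∀ x, p' (φ x) = q (p x))
    (k : WedgeQuot j) : wedgeQuotToTensor j' p' h' (wedgeInduced j j' φ hφ k) =
      TensorProduct.map q φ (wedgeQuotToTensor j p h k) := by
  have : wedgeQuotToTensor j' p' h' ∘ₗ wedgeInduced j j' φ hφ =
      TensorProduct.map q φ ∘ₗ wedgeQuotToTensor j p h := by
    apply wedgeQuot_hom_ext
    intro x y
    simp only [LinearMap.comp_apply, wedgeInduced_apply, TensorProduct.map_tmul,
      wedgeQuotToTensor_apply, map_sub, hq]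
  exact LinearMap.congr_fun this k

/-- If `δ` takes values in `I'` and `φ` sends `I` into `I'`, then `x ⊗ y ↦ φ(x) ∧ δ(y)` defines a
map `E/I ⊗ E → Λ²(E')/Λ²(I')`. -/
theorem exists_wedge_homotopy {j : I →ₗ[R] E} {p : E →ₗ[R] Q} (hex : Function.Exact j p)
    (hp : Function.Surjective p) (j' : I' →ₗ[R] E') {E₁ : Type u} [AddCommGroup E₁] [Module R E₁]
    (φ : E →ₗ[R] E') (hφ : ∀ a, φ (j a) ∈ LinearMap.range j') (δ : E₁ →ₗ[R] E')
    (hδ : ∀ y, δ y ∈ LinearMap.range j') :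
    ∃ h : Q ⊗[R] E₁ →ₗ[R] WedgeQuot j', ∀ x y, h (p x ⊗ₜ y) = tensorToWedge j' (φ x ⊗ₜ δ y) := by
  let B : E ⊗[R] E₁ →ₗ[R] WedgeQuot j' := tensorToWedge j' ∘ₗ TensorProduct.map φ δ
  have hB : LinearMap.ker (p.rTensor E₁) ≤ LinearMap.ker B := by
    rw [(rTensor_exact E₁ hex hp).linearMap_ker_eq, LinearMap.range_le_ker_iff]
    apply TensorProduct.ext'
    intro a y
    exact tensorToWedge_of_mem j' (hφ a) (hδ y)
  refine ⟨factorThrough (p.rTensor E₁) (LinearMap.rTensor_surjective _ hp) B hB, fun x y => ?_⟩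
  exact factorThrough_apply (p.rTensor E₁) _ B hB (x ⊗ₜ y)

/-- Two maps `E → E'` of pairs that agree modulo `I'` induce the same map on the kernels of
`Λ²(E)/Λ²(I) → E/I ⊗ E`. -/
theorem wedgeInduced_eq_of_sub_mem {j : I →ₗ[R] E} {p : E →ₗ[R] Q} (h : p ∘ₗ j = 0)
    (hex : Function.Exact j p) (hp : Function.Surjective p) (j' : I' →ₗ[R] E')
    (φ φ' : E →ₗ[R] E') (hφ : ∀ a, φ (j a) ∈ LinearMap.range j')
    (hφ' : ∀ a, φ' (j a) ∈ LinearMap.range j') (hδ : ∀ x, (φ' - φ) x ∈ LinearMap.range j')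
    {k : WedgeQuot j} (hk : k ∈ wedgeQuotKer j p h) :
    wedgeInduced j j' φ' hφ' k = wedgeInduced j j' φ hφ k := by
  obtain ⟨H, hH⟩ := exists_wedge_homotopy hex hp j' φ hφ (φ' - φ) hδ
  have key : wedgeInduced j j' φ' hφ' =
      wedgeInduced j j' φ hφ + H ∘ₗ wedgeQuotToTensor j p h := by
    apply wedgeQuot_hom_ext
    intro x y
    obtain ⟨d, rfl⟩ : ∃ d, φ' = φ + d := ⟨φ' - φ, by abel⟩
    have hd : ∀ x, d x ∈ LinearMap.range j' := by simpa using hδ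
    simp only [LinearMap.add_apply, LinearMap.comp_apply, wedgeInduced_apply,
      TensorProduct.map_tmul, wedgeQuotToTensor_apply, map_sub, hH, add_sub_cancel_left,
      TensorProduct.add_tmul, TensorProduct.tmul_add, map_add,
      tensorToWedge_of_mem j' (hd x) (hd y), tensorToWedge_swap j' (d x) (φ y)]
    abel
  rw [key, LinearMap.add_apply, LinearMap.comp_apply, LinearMap.mem_ker.1 hk, map_zero, add_zero]

/-- For a surjection `q : E' → E` with `I' = q⁻¹(I)`, the kernel of `Λ²(E')/Λ²(I') → Λ²(E)/Λ²(I)`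
consists of the sums of elements `x ∧ n` with `n` in the kernel of `q`. -/
theorem ker_wedgeInduced_le (j' : I' →ₗ[R] E') (j : I →ₗ[R] E) (q : E' →ₗ[R] E)
    {n : N →ₗ[R] E'} (hn : Function.Exact n q)
    (hq : ∀ a, q (j' a) ∈ LinearMap.range j) (hqs : Function.Surjective q)
    (hj : ∀ x, q x ∈ LinearMap.range j → x ∈ LinearMap.range j') :
    LinearMap.ker (wedgeInduced j' j q hq) ≤
      LinearMap.range (tensorToWedge j' ∘ₗ n.lTensor E') := by
  set S := LinearMap.range (tensorToWedge j' ∘ₗ n.lTensor E') with hS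
  let B' : E' ⊗[R] E' →ₗ[R] WedgeQuot j' ⧸ S := S.mkQ ∘ₗ tensorToWedge j'
  have hqq : Function.Surjective (TensorProduct.map q q) := TensorProduct.map_surjective hqs hqs
  have hS' : ∀ x a, tensorToWedge j' (x ⊗ₜ n a) ∈ S := fun x a =>
    ⟨x ⊗ₜ a, rfl⟩
  have hB' : LinearMap.ker (TensorProduct.map q q) ≤ LinearMap.ker B' := by
    rw [TensorProduct.map_ker hn hqs hn hqs, sup_le_iff, LinearMap.range_le_ker_iff,
      LinearMap.range_le_ker_iff]
    constructor
    · apply TensorProduct.ext'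
      intro x a
      exact (Submodule.Quotient.mk_eq_zero _).2 (hS' x a)
    · apply TensorProduct.ext'
      intro a x
      refine (Submodule.Quotient.mk_eq_zero _).2 ?_
      change tensorToWedge j' (n a ⊗ₜ x) ∈ S
      rw [tensorToWedge_swap]
      exact S.neg_mem (hS' x a)
  have hB := factorThrough_apply (TensorProduct.map q q) hqq B' hB'
  let s := wedgeLift j (factorThrough (TensorProduct.map q q) hqq B' hB')
    (fun x => by
      obtain ⟨x, rfl⟩ := hqs x
      refine (hB (x ⊗ₜ x)).trans ?_
      change S.mkQ (tensorToWedge j' (x ⊗ₜ x)) = 0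
      rw [tensorToWedge_self, map_zero])
    (fun a b => by
      obtain ⟨x, hx⟩ := hqs (j a)
      obtain ⟨y, hy⟩ := hqs (j b)
      rw [← hx, ← hy]
      refine (hB (x ⊗ₜ y)).trans ?_
      change S.mkQ (tensorToWedge j' (x ⊗ₜ y)) = 0
      rw [tensorToWedge_of_mem j' (hj x (hx ▸ ⟨a, rfl⟩)) (hj y (hy ▸ ⟨b, rfl⟩)), map_zero])
  intro k hk
  obtain ⟨t, rfl⟩ := tensorToWedge_surjective j' k
  have h1 : s (wedgeInduced j' j q hq (tensorToWedge j' t)) = S.mkQ (tensorToWedge j' t) := by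
    rw [wedgeInduced_apply, wedgeLift_apply, hB]
    rfl
  rw [LinearMap.mem_ker.1 hk, map_zero] at h1
  exact (Submodule.Quotient.mk_eq_zero _).1 h1.symm

/-- For a surjection `q : E' → E` with `I' = q⁻¹(I)`, the kernel of `Λ²(E')/Λ²(I') → E/I ⊗ E'`
maps onto the kernel of `Λ²(E)/Λ²(I) → E/I ⊗ E`. -/
theorem wedgeInduced_surjective_on_ker (j' : I' →ₗ[R] E') (j : I →ₗ[R] E) (q : E' →ₗ[R] E)
    {n : N →ₗ[R] E'} (hn : Function.Exact n q)
    (hq : ∀ a, q (j' a) ∈ LinearMap.range j) (hqs : Function.Surjective q)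
    (p : E →ₗ[R] Q) (h : p ∘ₗ j = 0) (hp : Function.Surjective p) (h' : (p ∘ₗ q) ∘ₗ j' = 0)
    {k : WedgeQuot j} (hk : k ∈ wedgeQuotKer j p h) :
    ∃ k' ∈ wedgeQuotKer j' (p ∘ₗ q) h', wedgeInduced j' j q hq k' = k := by
  obtain ⟨t, rfl⟩ := tensorToWedge_surjective j k
  obtain ⟨t, rfl⟩ := TensorProduct.map_surjective hqs hqs t
  have h1 : q.lTensor Q (wedgeQuotToTensor j' (p ∘ₗ q) h' (tensorToWedge j' t)) = 0 := by
    have := wedgeQuotToTensor_wedgeInduced j' (p ∘ₗ q) h' j p h q hq .id (fun _ => rfl)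
      (tensorToWedge j' t)
    rw [wedgeInduced_apply, LinearMap.mem_ker.1 hk] at this
    exact this.symm
  obtain ⟨s, hs⟩ := (lTensor_exact Q hn hqs _).1 h1
  obtain ⟨s, rfl⟩ := LinearMap.rTensor_surjective N (hp.comp hqs)
    (g := p ∘ₗ q) s
  refine ⟨tensorToWedge j' t - tensorToWedge j' (n.lTensor E' s), ?_, ?_⟩
  · have : wedgeQuotToTensor j' (p ∘ₗ q) h' ∘ₗ tensorToWedge j' ∘ₗ
        n.lTensor E' =
        n.lTensor Q ∘ₗ (p ∘ₗ q).rTensor N := by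
      apply TensorProduct.ext'
      intro x a
      have hn : q (n a) = 0 := (hn _).2 ⟨a, rfl⟩
      simp [wedgeQuotToTensor_apply, hn]
    have := LinearMap.congr_fun this s
    simp only [LinearMap.comp_apply] at this
    rw [wedgeQuotKer, LinearMap.mem_ker, map_sub, this, sub_eq_zero]
    exact hs.symm
  · have : (tensorToWedge j ∘ₗ TensorProduct.map q q) ∘ₗ n.lTensor E' =
        0 := by
      apply TensorProduct.ext'
      intro x a
      have hn : q (n a) = 0 := (hn _).2 ⟨a, rfl⟩
      simp [hn]
    rw [map_sub, wedgeInduced_apply, wedgeInduced_apply, sub_eq_self]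
    exact LinearMap.congr_fun this s

/-! ### The Koszul complex -/

/-- The quotient of `E ⊗ E` by the elements `a ⊗ b - b ⊗ a`, where `a` and `b` come from `I`. -/
abbrev KoszulQuot (j : I →ₗ[R] E) : Type u :=
  (E ⊗[R] E) ⧸ LinearMap.range (TensorProduct.map j j ∘ₗ wedgeToTensor R I)

/-- The projection `E ⊗ E → KoszulQuot j`. -/
abbrev koszulMk (j : I →ₗ[R] E) : E ⊗[R] E →ₗ[R] KoszulQuot j :=
  (LinearMap.range (TensorProduct.map j j ∘ₗ wedgeToTensor R I)).mkQ

theorem koszulMk_eq_zero_iff (j : I →ₗ[R] E) (t : E ⊗[R] E) : koszulMk j t = 0 ↔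
    t ∈ LinearMap.range (TensorProduct.map j j ∘ₗ wedgeToTensor R I) :=
  Submodule.Quotient.mk_eq_zero _

theorem koszulMk_swap (j : I →ₗ[R] E) {x y : E} (hx : x ∈ LinearMap.range j)
    (hy : y ∈ LinearMap.range j) : koszulMk j (y ⊗ₜ x) = koszulMk j (x ⊗ₜ y) := by
  obtain ⟨a, rfl⟩ := hx
  obtain ⟨b, rfl⟩ := hy
  rw [← sub_eq_zero, ← map_sub, ← LinearMap.mem_ker, Submodule.ker_mkQ]
  refine ⟨exteriorPower.ιMulti R 2 ![b, a], ?_⟩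
  rw [LinearMap.comp_apply, wedgeToTensor_ιMulti]
  simp

theorem range_wedgeToTensor_le {Z : Submodule R (I ⊗[R] I)}
    (h : ∀ a b, a ⊗ₜ b - b ⊗ₜ a ∈ Z) : LinearMap.range (wedgeToTensor R I) ≤ Z := by
  rw [LinearMap.range_eq_map, ← exteriorPower.ιMulti_span, Submodule.map_span, Submodule.span_le]
  rintro _ ⟨_, ⟨v, rfl⟩, rfl⟩
  rw [wedgeToTensor_ιMulti]
  exact h _ _

/-- Linear maps out of `KoszulQuot j`. -/
def koszulLift (j : I →ₗ[R] E) (B : E ⊗[R] E →ₗ[R] Y)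
    (hB : ∀ a b, B (j a ⊗ₜ j b) = B (j b ⊗ₜ j a)) : KoszulQuot j →ₗ[R] Y :=
  Submodule.liftQ _ B (by
    rw [LinearMap.range_comp, Submodule.map_le_iff_le_comap]
    refine range_wedgeToTensor_le fun a b => ?_
    simp [hB a b])

theorem koszulLift_apply (j : I →ₗ[R] E) (B : E ⊗[R] E →ₗ[R] Y)
    (hB : ∀ a b, B (j a ⊗ₜ j b) = B (j b ⊗ₜ j a)) (t : E ⊗[R] E) :
    koszulLift j B hB (koszulMk j t) = B t :=
  Submodule.liftQ_apply _ _ _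

/-- The map `Λ²(E)/Λ²(I) → KoszulQuot j`, `x ∧ y ↦ x ⊗ y - y ⊗ x`. -/
def wedgeToKoszul (j : I →ₗ[R] E) : WedgeQuot j →ₗ[R] KoszulQuot j :=
  wedgeLift j (koszulMk j ∘ₗ (.id - (TensorProduct.comm R E E).toLinearMap))
    (fun x => by simp)
    (fun a b => by
      change koszulMk j (j a ⊗ₜ j b - j b ⊗ₜ j a) = 0
      rw [map_sub, koszulMk_swap j ⟨b, rfl⟩ ⟨a, rfl⟩, sub_self])

theorem wedgeToKoszul_apply (j : I →ₗ[R] E) (t : E ⊗[R] E) :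
    wedgeToKoszul j (tensorToWedge j t) = koszulMk j (t - TensorProduct.comm R E E t) :=
  wedgeLift_apply j _ _ _ t

/-- The map of Koszul quotients induced by a map `φ : E → E'` that sends the image of `I` into the
image of `I'`. -/
def koszulInduced (j : I →ₗ[R] E) (j' : I' →ₗ[R] E') (φ : E →ₗ[R] E')
    (hφ : ∀ a, φ (j a) ∈ LinearMap.range j') : KoszulQuot j →ₗ[R] KoszulQuot j' :=
  koszulLift j (koszulMk j' ∘ₗ TensorProduct.map φ φ) fun a b =>
    koszulMk_swap j' (hφ b) (hφ a)

theorem koszulInduced_apply (j : I →ₗ[R] E) (j' : I' →ₗ[R] E') (φ : E →ₗ[R] E')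
    (hφ : ∀ a, φ (j a) ∈ LinearMap.range j') (t : E ⊗[R] E) :
    koszulInduced j j' φ hφ (koszulMk j t) = koszulMk j' (TensorProduct.map φ φ t) :=
  koszulLift_apply j _ _ t

theorem wedgeToKoszul_wedgeInduced (j : I →ₗ[R] E) (j' : I' →ₗ[R] E') (φ : E →ₗ[R] E')
    (hφ : ∀ a, φ (j a) ∈ LinearMap.range j') (k : WedgeQuot j) :
    wedgeToKoszul j' (wedgeInduced j j' φ hφ k) =
      koszulInduced j j' φ hφ (wedgeToKoszul j k) := by
  have : wedgeToKoszul j' ∘ₗ wedgeInduced j j' φ hφ =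
      koszulInduced j j' φ hφ ∘ₗ wedgeToKoszul j := by
    apply wedgeQuot_hom_ext
    intro x y
    rw [LinearMap.comp_apply, LinearMap.comp_apply, wedgeInduced_apply, wedgeToKoszul_apply,
      wedgeToKoszul_apply, koszulInduced_apply]
    simp
  exact LinearMap.congr_fun this k

/-- For a free module `E`, the map `Λ²(E)/Λ²(I) → KoszulQuot j` is injective: a total order on the
basis provides the retraction with `eₐ ⊗ e_b ↦ eₐ ∧ e_b` if `a < b` and `eₐ ⊗ e_b ↦ 0`
otherwise. -/
theorem wedgeToKoszul_injective {A : Type u} (j : I →ₗ[R] (A →₀ R)) :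
    Function.Injective (wedgeToKoszul j) := by
  classical
  let _ : LinearOrder A := linearOrderOfSTO WellOrderingRel
  let ρ : (A →₀ R) ⊗[R] (A →₀ R) →ₗ[R] WedgeQuot j := TensorProduct.lift
    (Finsupp.linearCombination R fun a => Finsupp.linearCombination R fun b =>
      if a < b then tensorToWedge j (Finsupp.single a (1 : R) ⊗ₜ Finsupp.single b (1 : R)) else 0)
  have hρ : ρ - ρ ∘ₗ (TensorProduct.comm R (A →₀ R) (A →₀ R)).toLinearMap =
      tensorToWedge j := by
    ext a b
    have h : ∀ a b, ρ (Finsupp.single a (1 : R) ⊗ₜ Finsupp.single b (1 : R)) =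
        if a < b then tensorToWedge j (Finsupp.single a (1 : R) ⊗ₜ Finsupp.single b (1 : R))
        else 0 := by
      intro a b
      simp [ρ]
    change ρ (Finsupp.single a (1 : R) ⊗ₜ Finsupp.single b (1 : R)) -
      ρ (Finsupp.single b (1 : R) ⊗ₜ Finsupp.single a (1 : R)) =
        tensorToWedge j (Finsupp.single a (1 : R) ⊗ₜ Finsupp.single b (1 : R))
    rw [h, h]
    rcases lt_trichotomy a b with hab | rfl | hab
    · rw [if_pos hab, if_neg hab.not_gt, sub_zero]
    · rw [tensorToWedge_self, if_neg (lt_irrefl a), sub_zero]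
    · rw [if_neg hab.not_gt, if_pos hab, zero_sub, ← tensorToWedge_swap]
  have hρ' : ∀ t, ρ (t - TensorProduct.comm R (A →₀ R) (A →₀ R) t) = tensorToWedge j t :=
    fun t => (map_sub ρ _ _).trans (LinearMap.congr_fun hρ t)
  let r : KoszulQuot j →ₗ[R] WedgeQuot j := koszulLift j ρ fun a b => by
    rw [← sub_eq_zero, ← map_sub]
    exact (hρ' (j a ⊗ₜ j b)).trans (tensorToWedge_of_mem j ⟨a, rfl⟩ ⟨b, rfl⟩)
  refine Function.LeftInverse.injective (g := r) fun k => ?_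
  obtain ⟨t, rfl⟩ := tensorToWedge_surjective j k
  rw [wedgeToKoszul_apply, koszulLift_apply, hρ']

/-! ### The symmetric square as a quotient of the tensor square -/

theorem tensorToSym_surjective : Function.Surjective (tensorToSym R E) := by
  rw [← LinearMap.range_eq_top, ← top_le_iff, ← SymmetricPower.span_tprod_eq_top R (Fin 2) E,
    Submodule.span_le]
  rintro _ ⟨v, rfl⟩
  refine ⟨v 0 ⊗ₜ v 1, ?_⟩
  rw [tensorToSym_tmul, symMul]
  congr 1
  funext i
  fin_cases i <;> rfl

theorem symMul_comm (a b : E) : symMul R a b = symMul R b a := by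
  have h := SymmetricPower.tprod_equiv (R := R) (M := E) (ι := Fin 2) (Equiv.swap 0 1) ![b, a]
  rw [symMul, symMul, ← h]
  congr 1
  funext i
  fin_cases i <;> rfl

/-- The bilinear map `(v₀, v₁) ↦ B(v₀ ⊗ v₁)`. -/
def multilinearOfTensor (B : E ⊗[R] E →ₗ[R] Y) : MultilinearMap R (fun _ : Fin 2 => E) Y where
  toFun v := B (v 0 ⊗ₜ v 1)
  map_update_add' v i x y := by
    fin_cases i <;> simp [TensorProduct.add_tmul, TensorProduct.tmul_add]
  map_update_smul' v i c x := by
    fin_cases i <;> simp [← TensorProduct.smul_tmul', map_smul]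

theorem multilinearOfTensor_perm (B : E ⊗[R] E →ₗ[R] Y) (hB : ∀ x y, B (x ⊗ₜ y) = B (y ⊗ₜ x))
    (e : Equiv.Perm (Fin 2)) (v : Fin 2 → E) :
    multilinearOfTensor B (fun i => v (e i)) = multilinearOfTensor B v := by
  change B (v (e 0) ⊗ₜ v (e 1)) = B (v 0 ⊗ₜ v 1)
  have : (e 0 = 0 ∧ e 1 = 1) ∨ (e 0 = 1 ∧ e 1 = 0) := by
    revert e
    decide
  obtain ⟨h0, h1⟩ | ⟨h0, h1⟩ := this
  · rw [h0, h1]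
  · rw [h0, h1, hB]

/-- Linear maps out of the symmetric square, from symmetric linear maps out of the tensor
square. -/
def symLiftTensor (B : E ⊗[R] E →ₗ[R] Y) (hB : ∀ x y, B (x ⊗ₜ y) = B (y ⊗ₜ x)) :
    Sym[R]^2 E →ₗ[R] Y :=
  symLift (multilinearOfTensor B) (multilinearOfTensor_perm B hB)

theorem symLiftTensor_apply (B : E ⊗[R] E →ₗ[R] Y) (hB : ∀ x y, B (x ⊗ₜ y) = B (y ⊗ₜ x))
    (t : E ⊗[R] E) : symLiftTensor B hB (tensorToSym R E t) = B t := by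
  have : symLiftTensor B hB ∘ₗ tensorToSym R E = B :=
    TensorProduct.ext' fun x y => symLift_tprod _ (multilinearOfTensor_perm B hB) _
  exact LinearMap.congr_fun this t

/-- The map `KoszulQuot j → SP²(E)`. -/
def koszulToSym (j : I →ₗ[R] E) : KoszulQuot j →ₗ[R] Sym[R]^2 E :=
  koszulLift j (tensorToSym R E) fun a b => by
    rw [tensorToSym_tmul, tensorToSym_tmul, symMul_comm]

theorem koszulToSym_apply (j : I →ₗ[R] E) (t : E ⊗[R] E) :
    koszulToSym j (koszulMk j t) = tensorToSym R E t :=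
  koszulLift_apply j _ _ t

theorem koszulToSym_wedgeToKoszul (j : I →ₗ[R] E) (k : WedgeQuot j) :
    koszulToSym j (wedgeToKoszul j k) = 0 := by
  have : koszulToSym j ∘ₗ wedgeToKoszul j = 0 := by
    apply wedgeQuot_hom_ext
    intro x y
    rw [LinearMap.comp_apply, wedgeToKoszul_apply, koszulToSym_apply, map_sub,
      TensorProduct.comm_tmul, tensorToSym_tmul, tensorToSym_tmul, symMul_comm, sub_self,
      LinearMap.zero_apply]
  exact LinearMap.congr_fun this k

/-- Exactness of `Λ²(E)/Λ²(I) → KoszulQuot j → SP²(E)`. -/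
theorem exists_wedgeToKoszul_eq (j : I →ₗ[R] E) {z : KoszulQuot j} (hz : koszulToSym j z = 0) :
    ∃ k, wedgeToKoszul j k = z := by
  let S := LinearMap.range (wedgeToKoszul j)
  let s : Sym[R]^2 E →ₗ[R] KoszulQuot j ⧸ S := symLiftTensor (S.mkQ ∘ₗ koszulMk j) fun x y => by
    rw [← sub_eq_zero, ← map_sub]
    refine (Submodule.Quotient.mk_eq_zero _).2 ⟨tensorToWedge j (x ⊗ₜ y), ?_⟩
    rw [wedgeToKoszul_apply, TensorProduct.comm_tmul]
  obtain ⟨t, rfl⟩ := Submodule.mkQ_surjective _ z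
  have h : s (koszulToSym j (koszulMk j t)) = S.mkQ (koszulMk j t) := by
    rw [koszulToSym_apply, symLiftTensor_apply]
    rfl
  rw [hz, map_zero] at h
  exact (Submodule.Quotient.mk_eq_zero _).1 h.symm

/-- The map `KoszulQuot j → E/I ⊗ E` for `p : E → Q` vanishing on `I`. -/
def koszulToTensor (j : I →ₗ[R] E) (p : E →ₗ[R] Q) (h : p ∘ₗ j = 0) :
    KoszulQuot j →ₗ[R] Q ⊗[R] E :=
  koszulLift j (p.rTensor E) fun a b => by
    have h' : ∀ x, p (j x) = 0 := LinearMap.congr_fun h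
    simp [h']

theorem koszulToTensor_wedgeToKoszul (j : I →ₗ[R] E) (p : E →ₗ[R] Q) (h : p ∘ₗ j = 0)
    (k : WedgeQuot j) :
    koszulToTensor j p h (wedgeToKoszul j k) = wedgeQuotToTensor j p h k := by
  have : koszulToTensor j p h ∘ₗ wedgeToKoszul j = wedgeQuotToTensor j p h := by
    apply wedgeQuot_hom_ext
    intro x y
    rw [LinearMap.comp_apply, wedgeToKoszul_apply, koszulToTensor, koszulLift_apply,
      wedgeQuotToTensor_apply]
    simp
  exact LinearMap.congr_fun this k

end WedgeQuot

open FibrePower (entry entry_mk aug_entry)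

section Cycles

variable {R : Type} [CommRing R]

/-! ### The symmetric square of the Cech nerve in low degrees -/

/-- The chain complex of the simplicial module `SP²(X(A))`, where `X` is the Cech nerve. -/
abbrev symComplex (A : ModuleCat.{u} R) : ChainComplex (ModuleCat.{u} R) ℕ :=
  (AlgebraicTopology.alternatingFaceMapComplex _).obj
    (((SimplicialObject.whiskering _ _).obj (SP2 R)).obj (cechNerve.obj A))

/-- The alternating sum of the faces of `SP²(X(A))`. -/
def symD (A : ModuleCat.{u} R) (n : ℕ) :
    Sym[R]^2 (FibrePower A (Fin (n + 2))) →ₗ[R] Sym[R]^2 (FibrePower A (Fin (n + 1))) :=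
  ∑ i : Fin (n + 2), (-1 : ℤ) ^ (i : ℕ) • symMap (reindex A i.succAbove)

theorem symComplex_d (A : ModuleCat.{u} R) (n : ℕ) :
    (symComplex A).d (n + 1) n = ModuleCat.ofHom (symD A n) := by
  rw [AlgebraicTopology.alternatingFaceMapComplex_obj_d]
  apply ModuleCat.hom_ext
  simp only [AlgebraicTopology.AlternatingFaceMapComplex.objD, ModuleCat.hom_sum,
    ModuleCat.hom_zsmul]
  rfl

theorem symD_tensorToSym (A : ModuleCat.{u} R) (n : ℕ)
    (t : FibrePower A (Fin (n + 2)) ⊗[R] FibrePower A (Fin (n + 2))) :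
    symD A n (tensorToSym R _ t) = tensorToSym R _ (tensorD A A n t) := by
  simp only [symD, tensorD, LinearMap.sum_apply, LinearMap.smul_apply, map_sum, map_zsmul]
  refine Finset.sum_congr rfl fun i _ => ?_
  congr 1
  exact (LinearMap.congr_fun (tensorToSym_naturality (reindex A i.succAbove)) t).symm

/-- The kernel of the augmentation `R[A] → A`. -/
abbrev AugKer (A : ModuleCat.{u} R) : Type u := KerType (aug A)

/-- The inclusion of the kernel of the augmentation `R[A] → A`. -/
abbrev augKer (A : ModuleCat.{u} R) : AugKer A →ₗ[R] (A →₀ R) := kerIncl (aug A)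

theorem augKer_exact (A : ModuleCat.{u} R) : Function.Exact (augKer A) (aug A) :=
  kerIncl_exact (aug A)

theorem aug_comp_augKer (A : ModuleCat.{u} R) : aug A ∘ₗ augKer A = 0 :=
  (augKer_exact A).linearMap_comp_eq_zero

theorem mem_range_augKer {A : ModuleCat.{u} R} {x : A →₀ R} :
    x ∈ LinearMap.range (augKer A) ↔ aug A x = 0 :=
  (augKer_exact A x).symm

/-- The diagonal `R[A] → R[A] ×_A ⋯ ×_A R[A]`. -/
def diag (A : ModuleCat.{u} R) (ι : Type) : (A →₀ R) →ₗ[R] FibrePower A ι where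
  toFun f := .mk (fun _ => f) fun _ _ => rfl
  map_add' _ _ := rfl
  map_smul' _ _ := rfl

theorem entry_diag (A : ModuleCat.{u} R) {ι : Type} (i : ι) (f : A →₀ R) :
    entry i (diag A ι f) = f :=
  rfl

theorem reindex_diag (A : ModuleCat.{u} R) {ι κ : Type} (θ : ι → κ) (f : A →₀ R) :
    reindex A θ (diag A κ f) = diag A ι f :=
  rfl

/-- The map `r ↦ (0, r)` from the kernel of the augmentation to `R[A] ×_A R[A]`. -/
def kerPair (A : ModuleCat.{u} R) : AugKer A →ₗ[R] FibrePower A (Fin 2) where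
  toFun r := .mk ![0, augKer A r] (by
    have h : ∀ i, aug A (![0, augKer A r] i) = 0 := by
      intro i
      fin_cases i
      · exact map_zero _
      · exact mem_range_augKer.1 ⟨r, rfl⟩
    exact fun i j => (h i).trans (h j).symm)
  map_add' r s := FibrePower.ext fun i => by
    fin_cases i <;> simp [entry_mk]
  map_smul' c r := FibrePower.ext fun i => by
    fin_cases i <;> simp [entry_mk]

theorem entry_zero_kerPair (A : ModuleCat.{u} R) (r : AugKer A) :
    entry 0 (kerPair A r) = 0 :=
  rfl

theorem entry_one_kerPair (A : ModuleCat.{u} R) (r : AugKer A) :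
    entry 1 (kerPair A r) = augKer A r :=
  rfl

theorem exists_eq_diag_add_kerPair {A : ModuleCat.{u} R} (x : FibrePower A (Fin 2)) :
    ∃ f r, x = diag A (Fin 2) f + kerPair A r := by
  obtain ⟨r, hr⟩ : entry 1 x - entry 0 x ∈ LinearMap.range (augKer A) := by
    rw [mem_range_augKer, map_sub, aug_entry x 1 0, sub_self]
  refine ⟨entry 0 x, r, FibrePower.ext fun i => ?_⟩
  fin_cases i
  · simp [entry_diag, entry_zero_kerPair]
  · simp [entry_diag, entry_one_kerPair, hr]

/-! ### Cycles of `SP²(X(A))` in degree one -/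

/-- The difference of the two entries of an element of `R[A] ×_A R[A]`. -/
def entryDiff (A : ModuleCat.{u} R) : FibrePower A (Fin 2) →ₗ[R] (A →₀ R) := entry 1 - entry 0

theorem entryDiff_mem (A : ModuleCat.{u} R) (x : FibrePower A (Fin 2)) :
    entryDiff A x ∈ LinearMap.range (augKer A) := by
  rw [mem_range_augKer, entryDiff, LinearMap.sub_apply, map_sub, aug_entry x 1 0, sub_self]

theorem entry_one_eq (A : ModuleCat.{u} R) (x : FibrePower A (Fin 2)) :
    entry 1 x = entry 0 x + entryDiff A x := by
  rw [entryDiff, LinearMap.sub_apply, add_sub_cancel]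

/-- The map `x ⊗ y ↦ (x₁ - x₀) ⊗ y₁ + (y₁ - y₀) ⊗ x₀`. -/
def tensorKoszul (A : ModuleCat.{u} R) :
    FibrePower A (Fin 2) ⊗[R] FibrePower A (Fin 2) →ₗ[R] (A →₀ R) ⊗[R] (A →₀ R) :=
  TensorProduct.map (entryDiff A) (entry 1) +
    (TensorProduct.comm R _ _).toLinearMap ∘ₗ TensorProduct.map (entry 0) (entryDiff A)

theorem tensorKoszul_tmul (A : ModuleCat.{u} R) (x y : FibrePower A (Fin 2)) :
    tensorKoszul A (x ⊗ₜ y) = entryDiff A x ⊗ₜ entry 1 y + entryDiff A y ⊗ₜ entry 0 x :=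
  rfl

/-- The map `SP²(X₁(A)) → KoszulQuot`, `xy ↦ (x₁ - x₀) ⊗ y₁ + (y₁ - y₀) ⊗ x₀`. It compares the
complex of `SP²(X(A))` in degrees `≤ 1` with the Koszul complex `Λ²(K) → K ⊗ R[A] → SP²(R[A])`,
where `K` is the kernel of `R[A] → A`. -/
def symKoszul (A : ModuleCat.{u} R) :
    Sym[R]^2 (FibrePower A (Fin 2)) →ₗ[R] KoszulQuot (augKer A) :=
  symLiftTensor (koszulMk (augKer A) ∘ₗ tensorKoszul A) fun x y => by
    simp only [LinearMap.comp_apply, tensorKoszul_tmul, entry_one_eq, TensorProduct.tmul_add,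
      map_add, koszulMk_swap (augKer A) (entryDiff_mem A x) (entryDiff_mem A y)]
    abel

theorem symKoszul_tensorToSym (A : ModuleCat.{u} R)
    (t : FibrePower A (Fin 2) ⊗[R] FibrePower A (Fin 2)) :
    symKoszul A (tensorToSym R _ t) = koszulMk (augKer A) (tensorKoszul A t) :=
  symLiftTensor_apply _ _ t

theorem symKoszul_symD (A : ModuleCat.{u} R) (w : Sym[R]^2 (FibrePower A (Fin 3))) :
    symKoszul A (symD A 1 w) = 0 := by
  obtain ⟨t, rfl⟩ := tensorToSym_surjective w
  rw [symD_tensorToSym, symKoszul_tensorToSym]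
  have : koszulMk (augKer A) ∘ₗ tensorKoszul A ∘ₗ D1 A A = 0 := by
    apply TensorProduct.ext'
    intro x y
    have hx : entry 1 x - entry 0 x ∈ LinearMap.range (augKer A) := by
      rw [mem_range_augKer, map_sub, aug_entry x 1 0, sub_self]
    have hy : entry 2 y - entry 1 y ∈ LinearMap.range (augKer A) := by
      rw [mem_range_augKer, map_sub, aug_entry y 2 1, sub_self]
    have h := koszulMk_swap (augKer A) hx hy
    simp only [LinearMap.comp_apply, D1_tmul, map_add, map_sub, tensorKoszul_tmul, entryDiff,
      LinearMap.sub_apply, entry_reindex, LinearMap.zero_apply]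
    simp only [TensorProduct.sub_tmul, TensorProduct.tmul_sub, map_sub] at h ⊢
    simp only [Matrix.cons_val_zero, Matrix.cons_val_one]
    rw [← sub_eq_zero] at h
    rw [← h]
    abel
  exact LinearMap.congr_fun this t

/-- `symKoszul` is compatible with the maps to `SP²(R[A])`. -/
theorem koszulToSym_symKoszul (A : ModuleCat.{u} R) (c : Sym[R]^2 (FibrePower A (Fin 2))) :
    koszulToSym (augKer A) (symKoszul A c) = symMap (entry 0) (symD A 0 c) := by
  obtain ⟨t, rfl⟩ := tensorToSym_surjective c
  rw [symD_tensorToSym, symKoszul_tensorToSym, koszulToSym_apply]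
  have h : tensorToSym R _ ∘ₗ tensorKoszul A =
      symMap (entry 0) ∘ₗ tensorToSym R _ ∘ₗ D0 A A := by
    rw [← LinearMap.comp_assoc, ← tensorToSym_naturality, LinearMap.comp_assoc]
    apply TensorProduct.ext'
    intro x y
    simp only [LinearMap.comp_apply, D0_tmul, map_add, map_sub, tensorKoszul_tmul, entryDiff,
      LinearMap.sub_apply, entry_reindex, TensorProduct.sub_tmul, TensorProduct.map_tmul,
      tensorToSym_tmul, Matrix.cons_val_fin_one,
      symMul_comm (entry 1 y) (entry 0 x), symMul_comm (entry 0 y) (entry 0 x)]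
    abel
  exact LinearMap.congr_fun h t

theorem koszulToTensor_symKoszul (A : ModuleCat.{u} R) (c : Sym[R]^2 (FibrePower A (Fin 2))) :
    koszulToTensor (augKer A) (aug A) (aug_comp_augKer A) (symKoszul A c) = 0 := by
  obtain ⟨t, rfl⟩ := tensorToSym_surjective c
  rw [symKoszul_tensorToSym, koszulToTensor, koszulLift_apply]
  have h : (aug A).rTensor (A →₀ R) ∘ₗ tensorKoszul A = 0 := by
    apply TensorProduct.ext'
    intro x y
    simp [tensorKoszul_tmul, mem_range_augKer.1 (entryDiff_mem A x),
      mem_range_augKer.1 (entryDiff_mem A y)]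
  exact LinearMap.congr_fun h t

/-- The map `r ⊗ f ↦ (0, r)(f, f)`, a section of `symKoszul` on the image of `K ⊗ R[A]`, where `K`
is the kernel of `R[A] → A`. -/
def symSection (A : ModuleCat.{u} R) :
    AugKer A ⊗[R] (A →₀ R) →ₗ[R] Sym[R]^2 (FibrePower A (Fin 2)) :=
  tensorToSym R _ ∘ₗ TensorProduct.map (kerPair A) (diag A (Fin 2))

theorem symKoszul_symSection (A : ModuleCat.{u} R)
    (v : AugKer A ⊗[R] (A →₀ R)) :
    symKoszul A (symSection A v) = koszulMk (augKer A) ((augKer A).rTensor (A →₀ R) v) := by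
  rw [symSection, LinearMap.comp_apply, symKoszul_tensorToSym]
  congr 1
  have : tensorKoszul A ∘ₗ TensorProduct.map (kerPair A) (diag A (Fin 2)) =
      (augKer A).rTensor (A →₀ R) := by
    apply TensorProduct.ext'
    intro r f
    simp [tensorKoszul_tmul, entryDiff, entry_diag, entry_zero_kerPair, entry_one_kerPair]
  exact LinearMap.congr_fun this v

/-- In the quotient of `SP²(X₁)` by the boundaries, `(0, r)(s, s)` agrees with the expression
`(0, r)(0, s)`, which is symmetric in `r` and `s`. -/
theorem symMul_kerPair_diag_sub_mem (A : ModuleCat.{u} R) (r s : AugKer A) :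
    symMul R (kerPair A r) (diag A (Fin 2) (augKer A s)) - symMul R (kerPair A r) (kerPair A s) ∈
      LinearMap.range (symD A 1) := by
  -- the boundary of `(0, 0, r)(0, s, s)`
  refine ⟨tensorToSym R _ (reindex A ![0, 0, 1] (kerPair A r) ⊗ₜ
    reindex A ![0, 1, 1] (kerPair A s)), ?_⟩
  rw [symD_tensorToSym]
  change tensorToSym R _ (D1 A A _) = _
  have e1 : reindex A ![1, 2] (reindex A ![0, 0, 1] (kerPair A r)) = kerPair A r :=
    FibrePower.ext fun i => by fin_cases i <;> rfl
  have e2 : reindex A ![0, 2] (reindex A ![0, 0, 1] (kerPair A r)) = kerPair A r :=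
    FibrePower.ext fun i => by fin_cases i <;> rfl
  have e3 : reindex A ![0, 1] (reindex A ![0, 0, 1] (kerPair A r)) = 0 :=
    FibrePower.ext fun i => by fin_cases i <;> rfl
  have f1 : reindex A ![1, 2] (reindex A ![0, 1, 1] (kerPair A s)) = diag A (Fin 2) (augKer A s) :=
    FibrePower.ext fun i => by fin_cases i <;> rfl
  have f2 : reindex A ![0, 2] (reindex A ![0, 1, 1] (kerPair A s)) = kerPair A s :=
    FibrePower.ext fun i => by fin_cases i <;> rfl
  rw [D1_tmul, e1, e2, e3, f1, f2, TensorProduct.zero_tmul, add_zero, map_sub, tensorToSym_tmul,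
    tensorToSym_tmul]

theorem symMul_diag_mem (A : ModuleCat.{u} R) (f g : A →₀ R) :
    symMul R (diag A (Fin 2) f) (diag A (Fin 2) g) ∈ LinearMap.range (symD A 1) := by
  refine ⟨tensorToSym R _ (diag A (Fin 3) f ⊗ₜ diag A (Fin 3) g), ?_⟩
  rw [symD_tensorToSym]
  change tensorToSym R _ (D1 A A _) = _
  rw [D1_tmul]
  simp only [reindex_diag, sub_self, zero_add, tensorToSym_tmul]

/-- Every element of `SP²(X₁)` is, modulo boundaries, in the image of `symSection`. -/
theorem exists_sub_symSection_mem (A : ModuleCat.{u} R)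
    (w : Sym[R]^2 (FibrePower A (Fin 2))) :
    ∃ v, w - symSection A v ∈ LinearMap.range (symD A 1) := by
  obtain ⟨t, rfl⟩ := tensorToSym_surjective w
  induction t using TensorProduct.induction_on with
  | zero => exact ⟨0, by simp⟩
  | add t t' h h' =>
    obtain ⟨v, hv⟩ := h
    obtain ⟨v', hv'⟩ := h'
    refine ⟨v + v', ?_⟩
    have := Submodule.add_mem _ hv hv'
    rwa [map_add, map_add, add_sub_add_comm]
  | tmul x y =>
    obtain ⟨f, r, rfl⟩ := exists_eq_diag_add_kerPair x
    obtain ⟨g, s, rfl⟩ := exists_eq_diag_add_kerPair y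
    -- up to `(f, f)(g, g)`, the product is
    -- `(0, r)(g, g) + (0, r)(0, s) + (f, f)(0, s)`, and `(0, r)(0, s)` may be replaced by
    -- `(0, r)(s, s)`
    refine ⟨r ⊗ₜ g + r ⊗ₜ augKer A s + s ⊗ₜ f, ?_⟩
    have := Submodule.sub_mem _ (symMul_diag_mem A f g) (symMul_kerPair_diag_sub_mem A r s)
    convert this using 1
    simp only [symSection, LinearMap.comp_apply, map_add, TensorProduct.map_tmul,
      TensorProduct.add_tmul, TensorProduct.tmul_add, tensorToSym_tmul,
      symMul_comm (kerPair A s) (diag A (Fin 2) f)]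
    abel

theorem augKer_rTensor_injective (A : ModuleCat.{u} R) :
    Function.Injective ((augKer A).rTensor (A →₀ R)) :=
  Module.Flat.rTensor_preserves_injective_linearMap _ (kerIncl_injective _)

/-- The kernel of `symKoszul` consists of boundaries. -/
theorem mem_range_symD_of_symKoszul_eq_zero (A : ModuleCat.{u} R)
    {w : Sym[R]^2 (FibrePower A (Fin 2))} (hw : symKoszul A w = 0) :
    w ∈ LinearMap.range (symD A 1) := by
  obtain ⟨v, hv⟩ := exists_sub_symSection_mem A w
  suffices h : symSection A v ∈ LinearMap.range (symD A 1) by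
    have := Submodule.add_mem _ hv h
    rwa [sub_add_cancel] at this
  obtain ⟨b, hb⟩ := hv
  have h0 : koszulMk (augKer A) ((augKer A).rTensor (A →₀ R) v) = 0 := by
    have h := symKoszul_symD A b
    rw [hb, map_sub, hw, zero_sub, neg_eq_zero] at h
    rw [← symKoszul_symSection, h]
  obtain ⟨l, hl⟩ := (koszulMk_eq_zero_iff _ _).1 h0
  have hv : (augKer A).lTensor _ (wedgeToTensor R _ l) = v := by
    apply augKer_rTensor_injective
    rw [← hl, LinearMap.comp_apply, ← LinearMap.comp_apply ((augKer A).rTensor (A →₀ R)),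
      LinearMap.rTensor_comp_lTensor]
  rw [← hv]
  refine range_wedgeToTensor_le (Z := (LinearMap.range (symD A 1)).comap
    (symSection A ∘ₗ (augKer A).lTensor _)) (fun r s => ?_) ⟨l, rfl⟩
  have := Submodule.sub_mem _ (symMul_kerPair_diag_sub_mem A r s)
    (symMul_kerPair_diag_sub_mem A s r)
  rw [symMul_comm (kerPair A s) (kerPair A r), sub_sub_sub_cancel_right] at this
  rw [Submodule.mem_comap, map_sub]
  exact this

/-! ### The first homology group of `SP²(X(A))` -/

/-- The kernel of `Λ²(R[A])/Λ²(K) → A ⊗ R[A]`, where `K` is the kernel of `R[A] → A`. -/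
abbrev augWedgeKer (A : ModuleCat.{u} R) : Submodule R (WedgeQuot (augKer A)) :=
  wedgeQuotKer (augKer A) (aug A) (aug_comp_augKer A)

theorem exists_wedge_of_cycle (A : ModuleCat.{u} R) {c : Sym[R]^2 (FibrePower A (Fin 2))}
    (hc : symD A 0 c = 0) : ∃ k, wedgeToKoszul (augKer A) k = symKoszul A c :=
  exists_wedgeToKoszul_eq _ (by rw [koszulToSym_symKoszul, hc, map_zero])

theorem mem_augWedgeKer_of_eq (A : ModuleCat.{u} R) {c : Sym[R]^2 (FibrePower A (Fin 2))}
    {k : WedgeQuot (augKer A)} (h : wedgeToKoszul (augKer A) k = symKoszul A c) :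
    k ∈ augWedgeKer A := by
  refine LinearMap.mem_ker.2 ?_
  rw [← koszulToTensor_wedgeToKoszul, h, koszulToTensor_symKoszul]

theorem symMap_comp_apply {M N P : Type u} [AddCommGroup M] [AddCommGroup N] [AddCommGroup P]
    [Module R M] [Module R N] [Module R P] (g : N →ₗ[R] P) (f : M →ₗ[R] N) (x : Sym[R]^2 M) :
    symMap g (symMap f x) = symMap (g ∘ₗ f) x := by
  have : symMap g ∘ₗ symMap f = symMap (g ∘ₗ f) :=
    sym_hom_ext fun v => by simp [symMap_tprod]
  exact LinearMap.congr_fun this x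

theorem symMap_id_apply {M : Type u} [AddCommGroup M] [Module R M] (x : Sym[R]^2 M) :
    symMap (.id : M →ₗ[R] M) x = x := by
  have : symMap (.id : M →ₗ[R] M) = .id := sym_hom_ext fun v => symMap_tprod _ v
  exact LinearMap.congr_fun this x

theorem symMap_entry_zero_injective (A : ModuleCat.{u} R) :
    Function.Injective (symMap (R := R) (entry (A := A) (0 : Fin 1))) := by
  refine Function.LeftInverse.injective (g := symMap (diag A (Fin 1))) fun x => ?_
  rw [symMap_comp_apply]
  have : diag A (Fin 1) ∘ₗ entry 0 = .id := LinearMap.ext fun x => FibrePower.ext fun i => by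
    fin_cases i
    rfl
  rw [this, symMap_id_apply]

theorem exists_cycle_of_wedge (A : ModuleCat.{u} R) {k : WedgeQuot (augKer A)}
    (hk : k ∈ augWedgeKer A) :
    ∃ c, symD A 0 c = 0 ∧ wedgeToKoszul (augKer A) k = symKoszul A c := by
  obtain ⟨t, ht⟩ := Submodule.mkQ_surjective _ (wedgeToKoszul (augKer A) k)
  have h0 : (aug A).rTensor (A →₀ R) t = 0 := by
    rw [← koszulLift_apply (augKer A) ((aug A).rTensor (A →₀ R)), koszulMk, ht]
    exact (koszulToTensor_wedgeToKoszul (augKer A) (aug A) (aug_comp_augKer A) k).trans hk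
  obtain ⟨v, rfl⟩ := (rTensor_exact (A →₀ R) (augKer_exact A)
    (aug_surjective A) t).1 h0
  have hc : wedgeToKoszul (augKer A) k = symKoszul A (symSection A v) := by
    rw [symKoszul_symSection]
    exact ht.symm
  refine ⟨symSection A v, symMap_entry_zero_injective A ?_, hc⟩
  rw [map_zero, ← koszulToSym_symKoszul, ← hc, koszulToSym_wedgeToKoszul]

/-- The map from the cycles of `SP²(X(A))` in degree `1` to `Λ²(R[A])/Λ²(K)`, where `K` is the
kernel of `R[A] → A`. -/
def cycleToWedge (A : ModuleCat.{u} R) : LinearMap.ker (symD A 0) →ₗ[R] WedgeQuot (augKer A) :=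
  (LinearEquiv.ofInjective _ (wedgeToKoszul_injective (augKer A))).symm.toLinearMap ∘ₗ
    (symKoszul A ∘ₗ (LinearMap.ker (symD A 0)).subtype).codRestrict
      (LinearMap.range (wedgeToKoszul (augKer A))) fun c => exists_wedge_of_cycle A c.2

theorem wedgeToKoszul_cycleToWedge (A : ModuleCat.{u} R) (c : LinearMap.ker (symD A 0)) :
    wedgeToKoszul (augKer A) (cycleToWedge A c) = symKoszul A c.1 := by
  have := LinearEquiv.apply_symm_apply
    (LinearEquiv.ofInjective _ (wedgeToKoszul_injective (augKer A)))
    ⟨symKoszul A c.1, exists_wedge_of_cycle A c.2⟩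
  exact congrArg Subtype.val this

theorem cycleToWedge_eq_iff (A : ModuleCat.{u} R) (c : LinearMap.ker (symD A 0))
    (k : WedgeQuot (augKer A)) :
    cycleToWedge A c = k ↔ wedgeToKoszul (augKer A) k = symKoszul A c.1 := by
  rw [← (wedgeToKoszul_injective (augKer A)).eq_iff, wedgeToKoszul_cycleToWedge, eq_comm]

theorem augKer_map_mem {A B : ModuleCat.{u} R} (f : A ⟶ B) (r : AugKer A) :
    Finsupp.lmapDomain R R f (augKer A r) ∈ LinearMap.range (augKer B) := by
  rw [mem_range_augKer, aug_mapDomain, mem_range_augKer.1 ⟨r, rfl⟩, map_zero]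

/-- Naturality of `symKoszul`. -/
theorem symKoszul_naturality {A B : ModuleCat.{u} R} (f : A ⟶ B)
    (c : Sym[R]^2 (FibrePower A (Fin 2))) :
    symKoszul B (symMap (fibrePowerMap f (Fin 2)) c) =
      koszulInduced (augKer A) (augKer B) (Finsupp.lmapDomain R R f) (augKer_map_mem f)
        (symKoszul A c) := by
  obtain ⟨t, rfl⟩ := tensorToSym_surjective c
  have h0 := LinearMap.congr_fun (tensorToSym_naturality (fibrePowerMap f (Fin 2))) t
  rw [LinearMap.comp_apply, LinearMap.comp_apply] at h0
  rw [← h0, symKoszul_tensorToSym, symKoszul_tensorToSym, koszulInduced_apply]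
  congr 1
  have h : tensorKoszul B ∘ₗ TensorProduct.map (fibrePowerMap f (Fin 2))
        (fibrePowerMap f (Fin 2)) =
      TensorProduct.map (Finsupp.lmapDomain R R f) (Finsupp.lmapDomain R R f) ∘ₗ
        tensorKoszul A := by
    apply TensorProduct.ext'
    intro x y
    have he : ∀ (i : Fin 2) (x : FibrePower A (Fin 2)), entry i (fibrePowerMap f (Fin 2) x) =
        Finsupp.lmapDomain R R f (entry i x) := fun _ _ => rfl
    simp only [LinearMap.comp_apply, TensorProduct.map_tmul, tensorKoszul_tmul, entryDiff,
      LinearMap.sub_apply, he, map_add, map_sub]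
  exact LinearMap.congr_fun h t

/-! ### Cycles of `X(A) ⊗ X(B)` -/

/-- The map `x ⊗ y ↦ π(y₁ - y₀) ⊗ x₀`, where `π : R[B] → R[A]` is induced by `p : B → A`. -/
def tensorCycleMap {A B : ModuleCat.{u} R} (p : B ⟶ A) :
    XX A B 2 →ₗ[R] (A →₀ R) ⊗[R] (A →₀ R) :=
  (TensorProduct.comm R _ _).toLinearMap ∘ₗ
    TensorProduct.map (entry 0) (entryDiff A ∘ₗ fibrePowerMap p (Fin 2))

theorem tensorCycleMap_tmul {A B : ModuleCat.{u} R} (p : B ⟶ A) (x : FibrePower A (Fin 2))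
    (y : FibrePower B (Fin 2)) :
    tensorCycleMap p (x ⊗ₜ y) = entryDiff A (fibrePowerMap p (Fin 2) y) ⊗ₜ entry 0 x :=
  rfl

/-- The class in `Λ²(R[A])/Λ²(K)` of the image in `SP²(X(A))` of a cycle of `X(A) ⊗ X(B)`, where `K`
is the kernel of `R[A] → A`. The cycle condition turns the sum of `x₁ ⊗ π(y₁)` into that of
`x₀ ⊗ π(y₀)`, which makes the Koszul class antisymmetric. -/
theorem wedgeToKoszul_tensorCycle {A B : ModuleCat.{u} R} (p : B ⟶ A) (z : XX A B 2)
    (hz : D0 A B z = 0) :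
    wedgeToKoszul (augKer A) (tensorToWedge (augKer A) (tensorCycleMap p z)) =
      symKoszul A (tensorToSym R _ ((fibrePowerMap p (Fin 2)).lTensor _ z)) := by
  rw [wedgeToKoszul_apply, symKoszul_tensorToSym]
  have h : tensorKoszul A ∘ₗ (fibrePowerMap p (Fin 2)).lTensor _ +
      (TensorProduct.comm R _ _).toLinearMap ∘ₗ tensorCycleMap p = tensorCycleMap p +
        TensorProduct.map (entry 0) (entry 0 ∘ₗ fibrePowerMap p (Fin 1)) ∘ₗ D0 A B := by
    apply TensorProduct.ext'
    intro x y
    have h0 : entry 0 (fibrePowerMap p (Fin 1) (reindex B ![0] y)) =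
        entry 0 (fibrePowerMap p (Fin 2) y) := rfl
    have h1 : entry 0 (fibrePowerMap p (Fin 1) (reindex B ![1] y)) =
        entry 1 (fibrePowerMap p (Fin 2) y) := rfl
    have h2 : entry 0 (reindex A ![0] x) = entry 0 x := rfl
    have h3 : entry 0 (reindex A ![1] x) = entry 1 x := rfl
    simp only [LinearMap.comp_apply, LinearMap.add_apply, LinearMap.sub_apply,
      LinearMap.lTensor_tmul, tensorKoszul_tmul, tensorCycleMap_tmul, LinearEquiv.coe_coe,
      TensorProduct.comm_tmul, D0_tmul, map_sub, TensorProduct.map_tmul, h0, h1, h2, h3,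
      entryDiff, TensorProduct.sub_tmul]
    abel
  have h' := LinearMap.congr_fun h z
  simp only [LinearMap.comp_apply, LinearMap.add_apply, hz, map_zero, add_zero] at h'
  congr 1
  exact sub_eq_of_eq_add h'.symm

end Cycles

section Homology

variable {R : Type} [CommRing R]

/-! ### Classes of cycles -/

/-- The cycles of a chain complex of modules in degree `1`. -/
abbrev oneCycles (C : ChainComplex (ModuleCat.{u} R) ℕ) : Submodule R (C.X 1) :=
  LinearMap.ker (C.d 1 0).hom

/-- The class in `H₁` of a cycle. -/
def cycleClass (C : ChainComplex (ModuleCat.{u} R) ℕ) : oneCycles C →ₗ[R] C.homology 1 :=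
  (C.liftCycles (ModuleCat.ofHom (oneCycles C).subtype) 0 (by simp)
    (ModuleCat.hom_ext (LinearMap.ext fun x => x.2)) ≫ C.homologyπ 1).hom

theorem cycleClass_surjective (C : ChainComplex (ModuleCat.{u} R) ℕ) :
    Function.Surjective (cycleClass C) := by
  intro h
  obtain ⟨c, rfl⟩ := (ModuleCat.epi_iff_surjective (C.homologyπ 1)).1 inferInstance h
  refine ⟨⟨C.iCycles 1 c, ConcreteCategory.congr_hom (C.iCycles_d 1 0) c⟩, ?_⟩
  refine congrArg (C.homologyπ 1) ?_
  apply (ModuleCat.mono_iff_injective (C.iCycles 1)).1 inferInstance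
  exact ConcreteCategory.congr_hom (C.liftCycles_i (ModuleCat.ofHom (oneCycles C).subtype) 0
    (by simp) (ModuleCat.hom_ext (LinearMap.ext fun x => x.2))) _

theorem cycleClass_eq_zero_iff (C : ChainComplex (ModuleCat.{u} R) ℕ) (z : oneCycles C) :
    cycleClass C z = 0 ↔ ∃ w : C.X 2, C.d 2 1 w = z.1 := by
  have hi : C.iCycles 1 (C.liftCycles (ModuleCat.ofHom (oneCycles C).subtype) 0 (by simp)
      (ModuleCat.hom_ext (LinearMap.ext fun x => x.2)) z) = z.1 :=
    ConcreteCategory.congr_hom (C.liftCycles_i (ModuleCat.ofHom (oneCycles C).subtype) 0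
      (by simp) (ModuleCat.hom_ext (LinearMap.ext fun x => x.2))) z
  constructor
  · intro h
    obtain ⟨w, hw⟩ := (ShortComplex.moduleCat_exact_iff _).1
      (ShortComplex.exact_of_g_is_cokernel
        (ShortComplex.mk (C.toCycles 2 1) (C.homologyπ 1) (C.toCycles_comp_homologyπ 2 1))
        (C.homologyIsCokernel 2 1 (by simp))) _ h
    refine ⟨w, ?_⟩
    exact (ConcreteCategory.congr_hom (C.toCycles_i 2 1) w).symm.trans
      ((congrArg (C.iCycles 1) hw).trans hi)
  · rintro ⟨w, hw⟩
    have : C.toCycles 2 1 w = C.liftCycles (ModuleCat.ofHom (oneCycles C).subtype) 0 (by simp)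
        (ModuleCat.hom_ext (LinearMap.ext fun x => x.2)) z := by
      apply (ModuleCat.mono_iff_injective (C.iCycles 1)).1 inferInstance
      rw [hi, ← hw]
      exact ConcreteCategory.congr_hom (C.toCycles_i 2 1) w
    refine (congrArg (C.homologyπ 1) this.symm).trans ?_
    exact ConcreteCategory.congr_hom (C.toCycles_comp_homologyπ 2 1) w

theorem homologyMap_cycleClass {C D : ChainComplex (ModuleCat.{u} R) ℕ} (f : C ⟶ D)
    (z : oneCycles C) (z' : oneCycles D) (hz : f.f 1 z.1 = z'.1) :
    HomologicalComplex.homologyMap f 1 (cycleClass C z) = cycleClass D z' := by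
  refine (ConcreteCategory.congr_hom (HomologicalComplex.homologyπ_naturality f 1) _).trans ?_
  refine congrArg (D.homologyπ 1) ?_
  apply (ModuleCat.mono_iff_injective (D.iCycles 1)).1 inferInstance
  have h1 := ConcreteCategory.congr_hom (HomologicalComplex.cyclesMap_i f 1)
    (C.liftCycles (ModuleCat.ofHom (oneCycles C).subtype) 0 (by simp)
      (ModuleCat.hom_ext (LinearMap.ext fun x => x.2)) z)
  have h2 := ConcreteCategory.congr_hom (C.liftCycles_i (ModuleCat.ofHom (oneCycles C).subtype) 0
    (by simp) (ModuleCat.hom_ext (LinearMap.ext fun x => x.2))) z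
  have h3 := ConcreteCategory.congr_hom (D.liftCycles_i (ModuleCat.ofHom (oneCycles D).subtype) 0
    (by simp) (ModuleCat.hom_ext (LinearMap.ext fun x => x.2))) z'
  refine h1.trans ?_
  refine (congrArg (f.f 1) h2).trans ?_
  exact hz.trans h3.symm

end Homology

section FirstDerived

variable {R : Type} [CommRing R]

/-- The class in `H₁(SP²(X(A)))` of a cycle. -/
def symClass (A : ModuleCat.{u} R) : LinearMap.ker (symD A 0) →ₗ[R] (symComplex A).homology 1 :=
  cycleClass (symComplex A) ∘ₗ Submodule.inclusion (by
    rw [oneCycles, symComplex_d]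
    exact le_rfl)

theorem symClass_surjective (A : ModuleCat.{u} R) : Function.Surjective (symClass A) := by
  intro x
  obtain ⟨⟨c, hc⟩, rfl⟩ := cycleClass_surjective _ x
  refine ⟨⟨c, ?_⟩, rfl⟩
  rw [LinearMap.mem_ker, symComplex_d] at hc
  exact hc

theorem symClass_eq_zero_iff (A : ModuleCat.{u} R) (c : LinearMap.ker (symD A 0)) :
    symClass A c = 0 ↔ c.1 ∈ LinearMap.range (symD A 1) := by
  refine (cycleClass_eq_zero_iff (symComplex A) _).trans ?_
  rw [symComplex_d]
  rfl

/-- The map `H₁(SP²(X(A))) → Λ²(R[A])/Λ²(K)`, where `K` is the kernel of `R[A] → A`. -/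
def homologyToWedge (A : ModuleCat.{u} R) : (symComplex A).homology 1 →ₗ[R] WedgeQuot (augKer A) :=
  factorThrough (symClass A) (symClass_surjective A) (cycleToWedge A) fun c hc => by
    obtain ⟨w, hw⟩ := (symClass_eq_zero_iff A c).1 hc
    rw [LinearMap.mem_ker, cycleToWedge_eq_iff, map_zero, ← hw, symKoszul_symD]

theorem homologyToWedge_symClass (A : ModuleCat.{u} R) (c : LinearMap.ker (symD A 0)) :
    homologyToWedge A (symClass A c) = cycleToWedge A c :=
  factorThrough_apply _ _ _ _ c

theorem homologyToWedge_injective (A : ModuleCat.{u} R) :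
    Function.Injective (homologyToWedge A) := by
  rw [injective_iff_map_eq_zero]
  intro x hx
  obtain ⟨c, rfl⟩ := symClass_surjective A x
  rw [homologyToWedge_symClass, cycleToWedge_eq_iff, map_zero] at hx
  exact (symClass_eq_zero_iff A c).2 (mem_range_symD_of_symKoszul_eq_zero A hx.symm)

theorem range_homologyToWedge (A : ModuleCat.{u} R) :
    LinearMap.range (homologyToWedge A) = augWedgeKer A := by
  ext k
  constructor
  · rintro ⟨x, rfl⟩
    obtain ⟨c, rfl⟩ := symClass_surjective A x
    rw [homologyToWedge_symClass]
    exact mem_augWedgeKer_of_eq A (wedgeToKoszul_cycleToWedge A c)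
  · intro hk
    obtain ⟨c, hc, hck⟩ := exists_cycle_of_wedge A hk
    exact ⟨symClass A ⟨c, hc⟩, by rwa [homologyToWedge_symClass, cycleToWedge_eq_iff]⟩

theorem symD_naturality {A B : ModuleCat.{u} R} (f : A ⟶ B) (n : ℕ)
    (c : Sym[R]^2 (FibrePower A (Fin (n + 2)))) :
    symD B n (symMap (fibrePowerMap f _) c) = symMap (fibrePowerMap f _) (symD A n c) := by
  simp only [symD, LinearMap.sum_apply, LinearMap.smul_apply, map_sum, map_zsmul,
    symMap_comp_apply]
  rfl

/-- The map induced by `f : A → B` on `H₁(SP²(X(-)))`. -/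
def symHomologyMap {A B : ModuleCat.{u} R} (f : A ⟶ B) :
    (symComplex A).homology 1 →ₗ[R] (symComplex B).homology 1 :=
  (HomologicalComplex.homologyMap ((AlgebraicTopology.alternatingFaceMapComplex _).map
    (((SimplicialObject.whiskering _ _).obj (SP2 R)).map (cechNerve.map f))) 1).hom

theorem homologyToWedge_naturality {A B : ModuleCat.{u} R} (f : A ⟶ B)
    (x : (symComplex A).homology 1) :
    homologyToWedge B (symHomologyMap f x) =
      wedgeInduced (augKer A) (augKer B) (Finsupp.lmapDomain R R f) (augKer_map_mem f)
        (homologyToWedge A x) := by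
  obtain ⟨c, rfl⟩ := symClass_surjective A x
  have h : symHomologyMap f (symClass A c) = symClass B
      ⟨symMap (fibrePowerMap f (Fin 2)) c.1, by
        rw [LinearMap.mem_ker, symD_naturality, LinearMap.mem_ker.1 c.2, map_zero]⟩ :=
    homologyMap_cycleClass _ _ _ rfl
  rw [h, homologyToWedge_symClass, homologyToWedge_symClass, cycleToWedge_eq_iff,
    wedgeToKoszul_wedgeInduced, wedgeToKoszul_cycleToWedge, symKoszul_naturality]

/-! ### Comparison with an arbitrary extension -/

/-- The set-theoretic section of a surjection, extended linearly to `R[A] → R[B]`. -/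
def linearSection {A B : ModuleCat.{u} R} {p : B ⟶ A} (hp : Function.Surjective p) :
    (A →₀ R) →ₗ[R] (B →₀ R) :=
  Finsupp.lmapDomain R R (Function.surjInv hp)

theorem map_linearSection {A B : ModuleCat.{u} R} {p : B ⟶ A} (hp : Function.Surjective p)
    (x : A →₀ R) : Finsupp.lmapDomain R R p (linearSection hp x) = x := by
  have h : Finsupp.lmapDomain R R p ∘ₗ linearSection hp = .id := by
    ext a
    simp [linearSection, Function.surjInv_eq hp]
  exact LinearMap.congr_fun h x

/-- A lift `R[A] → B` of the augmentation along a surjection `B → A`. -/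
def coverLift {A B : ModuleCat.{u} R} {p : B ⟶ A} (hp : Function.Surjective p) :
    (A →₀ R) →ₗ[R] B :=
  aug B ∘ₗ linearSection hp

theorem map_coverLift {A B : ModuleCat.{u} R} {p : B ⟶ A} (hp : Function.Surjective p)
    (x : A →₀ R) : p (coverLift hp x) = aug A x := by
  rw [coverLift, LinearMap.comp_apply, ← aug_mapDomain p, map_linearSection]

variable {I : Type u} [AddCommGroup I] [Module R I]

theorem lift_augKer_mem {A B : ModuleCat.{u} R} {p : B ⟶ A} {j : I →ₗ[R] B}
    (hex : Function.Exact j p) {φ : (A →₀ R) →ₗ[R] B} (hφ : ∀ x, p (φ x) = aug A x)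
    (r : AugKer A) : φ (augKer A r) ∈ LinearMap.range j := by
  refine (hex _).1 ?_
  rw [hφ]
  exact mem_range_augKer.1 ⟨r, rfl⟩

theorem comp_eq_zero_of_exact {A B : ModuleCat.{u} R} {p : B ⟶ A} {j : I →ₗ[R] B}
    (hex : Function.Exact j p) : p.hom ∘ₗ j = 0 :=
  LinearMap.ext fun x => (hex _).2 ⟨x, rfl⟩

/-- The map `H₁(SP²(X(A))) → Λ²(B)/Λ²(I)` for an extension `I → B → A`. -/
def homologyToWedgeQuot {A B : ModuleCat.{u} R} {p : B ⟶ A} {j : I →ₗ[R] B}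
    (hex : Function.Exact j p) (hp : Function.Surjective p) :
    (symComplex A).homology 1 →ₗ[R] WedgeQuot j :=
  wedgeInduced (augKer A) j (coverLift hp) (lift_augKer_mem hex (map_coverLift hp)) ∘ₗ
    homologyToWedge A

/-- The proof passes through `R[B]`: the kernel of `Λ²(R[B])/Λ²(J) → A ⊗ R[B]`, where `J` is the
preimage of `I`, maps onto the kernel of `Λ²(B)/Λ²(I) → A ⊗ B`, and `R[B] → B` agrees modulo `I`
with the composition `R[B] → R[A] → B`. -/
theorem range_homologyToWedgeQuot {A B : ModuleCat.{u} R} {p : B ⟶ A} {j : I →ₗ[R] B}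
    (hex : Function.Exact j p) (hp : Function.Surjective p) :
    LinearMap.range (homologyToWedgeQuot hex hp) =
      wedgeQuotKer j p.hom (comp_eq_zero_of_exact hex) := by
  rw [homologyToWedgeQuot, LinearMap.range_comp, range_homologyToWedge]
  apply le_antisymm
  · rintro _ ⟨k, hk, rfl⟩
    refine LinearMap.mem_ker.2 ?_
    rw [wedgeQuotToTensor_wedgeInduced (augKer A) (aug A) (aug_comp_augKer A) j p.hom
      (comp_eq_zero_of_exact hex) (coverLift hp) _ .id (map_coverLift hp),
      LinearMap.mem_ker.1 hk, map_zero]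
  · intro k hk
    set J := kerIncl (p.hom ∘ₗ aug B)
    have hJ : Function.Exact J (p.hom ∘ₗ aug B) := kerIncl_exact _
    have hq : ∀ a, aug B (J a) ∈ LinearMap.range j := fun a =>
      (hex _).1 ((hJ _).2 ⟨a, rfl⟩)
    obtain ⟨k', hk', rfl⟩ := wedgeInduced_surjective_on_ker J j (aug B) (augKer_exact B) hq
      (aug_surjective B) p.hom (comp_eq_zero_of_exact hex) hp hJ.linearMap_comp_eq_zero hk
    have hπ : ∀ a, Finsupp.lmapDomain R R p (J a) ∈ LinearMap.range (augKer A) := fun a => by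
      rw [mem_range_augKer, aug_mapDomain]
      exact (hJ _).2 ⟨a, rfl⟩
    refine ⟨wedgeInduced J (augKer A) (Finsupp.lmapDomain R R p) hπ k', ?_, ?_⟩
    · refine LinearMap.mem_ker.2 ?_
      rw [wedgeQuotToTensor_wedgeInduced J _ hJ.linearMap_comp_eq_zero (augKer A) (aug A)
        (aug_comp_augKer A) (Finsupp.lmapDomain R R p) _ .id (fun x => aug_mapDomain p x),
        LinearMap.mem_ker.1 hk', map_zero]
    · have hc : ∀ a, (coverLift hp ∘ₗ Finsupp.lmapDomain R R p) (J a) ∈ LinearMap.range j :=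
        fun a => by
          obtain ⟨r, hr⟩ := hπ a
          rw [LinearMap.comp_apply, ← hr]
          exact lift_augKer_mem hex (map_coverLift hp) r
      rw [wedgeInduced_comp (hc := hc)]
      refine wedgeInduced_eq_of_sub_mem hJ.linearMap_comp_eq_zero hJ (hp.comp (aug_surjective B))
        j _ _ _ _ (fun x => (hex _).1 ?_) hk'
      rw [LinearMap.sub_apply, map_sub, LinearMap.comp_apply, map_coverLift, aug_mapDomain,
        sub_self]

/-- If `u = ∑ f ⊗ n`, with `n` in the kernel of `R[B] → B`, vanishes in `A ⊗ R[B]`, then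
`∑ π(n) ⊗ f` comes from a cycle of `X(A) ⊗ X(B)`, where `π : R[B] → R[A]`. -/
theorem exists_tensorCycle {A B : ModuleCat.{u} R} (p : B ⟶ A)
    (u : (A →₀ R) ⊗[R] AugKer B)
    (hu : (aug A).rTensor (B →₀ R) ((augKer B).lTensor (A →₀ R) u) = 0) :
    ∃ z : XX A B 2, D0 A B z = 0 ∧ tensorCycleMap p z =
      TensorProduct.comm R _ _
        (TensorProduct.map .id (Finsupp.lmapDomain R R p ∘ₗ augKer B) u) := by
  obtain ⟨v, hv⟩ := (rTensor_exact (B →₀ R) (augKer_exact A) (aug_surjective A) _).1 hu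
  -- if `u = f ⊗ n` equals `v = r ⊗ g` in `R[A] ⊗ R[B]`, the cycle is
  -- `(f, f) ⊗ (0, n) - (0, r) ⊗ (g, g)`
  refine ⟨TensorProduct.map (diag A (Fin 2)) (kerPair B) u -
    TensorProduct.map (kerPair A) (diag B (Fin 2)) v, ?_, ?_⟩
  · have h1 : D0 A B ∘ₗ TensorProduct.map (diag A (Fin 2)) (kerPair B) =
        TensorProduct.map (diag A (Fin 1)) (diag B (Fin 1)) ∘ₗ
          (augKer B).lTensor (A →₀ R) := by
      apply TensorProduct.ext'
      intro f n
      have e0 : reindex B ![0] (kerPair B n) = 0 := FibrePower.ext fun i => by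
        fin_cases i
        rfl
      have e1 : reindex B ![1] (kerPair B n) = diag B (Fin 1) (augKer B n) :=
        FibrePower.ext fun i => by
          fin_cases i
          rfl
      simp [D0_tmul, e0, e1, reindex_diag]
    have h2 : D0 A B ∘ₗ TensorProduct.map (kerPair A) (diag B (Fin 2)) =
        TensorProduct.map (diag A (Fin 1)) (diag B (Fin 1)) ∘ₗ
          (augKer A).rTensor (B →₀ R) := by
      apply TensorProduct.ext'
      intro r g
      have e0 : reindex A ![0] (kerPair A r) = 0 := FibrePower.ext fun i => by
        fin_cases i
        rfl
      have e1 : reindex A ![1] (kerPair A r) = diag A (Fin 1) (augKer A r) :=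
        FibrePower.ext fun i => by
          fin_cases i
          rfl
      simp [D0_tmul, e0, e1, reindex_diag]
    have h1' := LinearMap.congr_fun h1 u
    have h2' := LinearMap.congr_fun h2 v
    rw [LinearMap.comp_apply, LinearMap.comp_apply] at h1' h2'
    rw [map_sub, h1', h2', hv, sub_self]
  · have h1 : tensorCycleMap p ∘ₗ TensorProduct.map (diag A (Fin 2)) (kerPair B) =
        (TensorProduct.comm R _ _).toLinearMap ∘ₗ
          TensorProduct.map .id (Finsupp.lmapDomain R R p ∘ₗ augKer B) := by
      apply TensorProduct.ext'
      intro f n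
      have e : entryDiff A (fibrePowerMap p (Fin 2) (kerPair B n)) =
          Finsupp.lmapDomain R R p (augKer B n) - Finsupp.lmapDomain R R p 0 := rfl
      rw [map_zero, sub_zero] at e
      rw [LinearMap.comp_apply, TensorProduct.map_tmul, tensorCycleMap_tmul, e]
      rfl
    have h2 : tensorCycleMap p ∘ₗ TensorProduct.map (kerPair A) (diag B (Fin 2)) = 0 := by
      apply TensorProduct.ext'
      intro r g
      rw [LinearMap.comp_apply, TensorProduct.map_tmul, tensorCycleMap_tmul, entry_zero_kerPair,
        TensorProduct.tmul_zero, LinearMap.zero_apply]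
    have h1' := LinearMap.congr_fun h1 u
    have h2' := LinearMap.congr_fun h2 v
    rw [LinearMap.comp_apply, LinearMap.comp_apply] at h1'
    rw [LinearMap.comp_apply, LinearMap.zero_apply] at h2'
    have h3 := map_add (tensorCycleMap p) (TensorProduct.map (diag A (Fin 2)) (kerPair B) u -
      TensorProduct.map (kerPair A) (diag B (Fin 2)) v)
      (TensorProduct.map (kerPair A) (diag B (Fin 2)) v)
    rw [sub_add_cancel, h2', add_zero] at h3
    rw [← h3, h1']
    rfl

/-- An element of the kernel of `Λ²(R[A])/Λ²(K) → A ⊗ R[A]` vanishes in `Λ²(B)/Λ²(I)` if and only if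
it is the class of a cycle of `X(A) ⊗ X(B)`, where `K` is the kernel of `R[A] → A`. -/
theorem wedgeInduced_coverLift_eq_zero_iff {A B : ModuleCat.{u} R} {p : B ⟶ A} {j : I →ₗ[R] B}
    (hex : Function.Exact j p) (hp : Function.Surjective p) {k : WedgeQuot (augKer A)}
    (hk : k ∈ augWedgeKer A) :
    wedgeInduced (augKer A) j (coverLift hp) (lift_augKer_mem hex (map_coverLift hp)) k = 0 ↔
      ∃ z : XX A B 2, D0 A B z = 0 ∧ tensorToWedge (augKer A) (tensorCycleMap p z) = k := by
  constructor
  · intro h0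
    set J := kerIncl (p.hom ∘ₗ aug B)
    have hJ : Function.Exact J (p.hom ∘ₗ aug B) := kerIncl_exact _
    have hq : ∀ a, aug B (J a) ∈ LinearMap.range j := fun a =>
      (hex _).1 ((hJ _).2 ⟨a, rfl⟩)
    have hπ : ∀ a, Finsupp.lmapDomain R R p (J a) ∈ LinearMap.range (augKer A) := fun a => by
      rw [mem_range_augKer, aug_mapDomain]
      exact (hJ _).2 ⟨a, rfl⟩
    have hσ : ∀ a, linearSection hp (augKer A a) ∈ LinearMap.range J := fun a => by
      refine (hJ _).1 ((map_coverLift hp _).trans ?_)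
      exact mem_range_augKer.1 ⟨a, rfl⟩
    have h1 : wedgeInduced J j (aug B) hq (wedgeInduced (augKer A) J (linearSection hp) hσ k) =
        0 := by
      rw [wedgeInduced_comp (hc := lift_augKer_mem hex (map_coverLift hp))]
      exact h0
    -- `k` is carried to `Λ²(R[B])/Λ²(J)` by the section and back by `R[B] → R[A]`
    obtain ⟨t, ht⟩ := ker_wedgeInduced_le J j (aug B) (augKer_exact B) hq (aug_surjective B)
      (fun x hx => (hJ _).1 ((hex _).2 hx)) h1
    -- `t` maps to zero in `A ⊗ R[B]`, since `k` maps to zero in `A ⊗ R[A]`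
    have h2 : (augKer B).lTensor A ((p.hom ∘ₗ aug B).rTensor (AugKer B) t) = 0 := by
      have h3 := wedgeQuotToTensor_wedgeInduced (augKer A) (aug A) (aug_comp_augKer A) J
        (p.hom ∘ₗ aug B) hJ.linearMap_comp_eq_zero (linearSection hp) hσ .id
        (fun x => map_coverLift hp x) k
      rw [LinearMap.mem_ker.1 hk, map_zero, ← ht] at h3
      rw [← h3]
      have h4 : wedgeQuotToTensor J (p.hom ∘ₗ aug B) hJ.linearMap_comp_eq_zero ∘ₗ
          (tensorToWedge J ∘ₗ (augKer B).lTensor _) =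
          (augKer B).lTensor A ∘ₗ (p.hom ∘ₗ aug B).rTensor (AugKer B) := by
        apply TensorProduct.ext'
        intro x n
        have hn : aug B (augKer B n) = 0 := mem_range_augKer.1 ⟨n, rfl⟩
        simp [wedgeQuotToTensor_apply, hn]
      exact (LinearMap.congr_fun h4 t).symm
    obtain ⟨z, hz, hz'⟩ := exists_tensorCycle p
      ((Finsupp.lmapDomain R R p).rTensor (AugKer B) t) (by
        have h5 : (aug A).rTensor (B →₀ R) ∘ₗ (augKer B).lTensor (A →₀ R) ∘ₗ
            (Finsupp.lmapDomain R R p).rTensor (AugKer B) =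
            (augKer B).lTensor A ∘ₗ (p.hom ∘ₗ aug B).rTensor (AugKer B) := by
          apply TensorProduct.ext'
          intro x n
          have := aug_mapDomain p x
          simp only [LinearMap.comp_apply, LinearMap.rTensor_tmul, LinearMap.lTensor_tmul, this]
        have h6 := LinearMap.congr_fun h5 t
        rw [LinearMap.comp_apply, LinearMap.comp_apply, LinearMap.comp_apply, h2] at h6
        exact h6)
    refine ⟨-z, by rw [map_neg, hz, neg_zero], ?_⟩
    have h7 : tensorToWedge (augKer A) ∘ₗ (TensorProduct.comm R _ _).toLinearMap ∘ₗ
        TensorProduct.map .id (Finsupp.lmapDomain R R p ∘ₗ augKer B) ∘ₗ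
          (Finsupp.lmapDomain R R p).rTensor (AugKer B) =
        -(wedgeInduced J (augKer A) (Finsupp.lmapDomain R R p) hπ ∘ₗ
          tensorToWedge J ∘ₗ (augKer B).lTensor _) := by
      apply TensorProduct.ext'
      intro x n
      simp only [LinearMap.comp_apply, LinearMap.neg_apply, LinearMap.rTensor_tmul,
        TensorProduct.map_tmul, LinearMap.lTensor_tmul, wedgeInduced_apply, LinearMap.id_apply,
        LinearEquiv.coe_coe, TensorProduct.comm_tmul]
      exact tensorToWedge_swap _ _ _
    have h8 := LinearMap.congr_fun h7 t
    simp only [LinearMap.comp_apply, LinearMap.neg_apply, LinearEquiv.coe_coe] at h8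
    rw [LinearMap.comp_apply] at ht
    refine (map_neg (tensorToWedge (augKer A) ∘ₗ tensorCycleMap p) z).trans ?_
    rw [LinearMap.comp_apply, hz', h8, neg_neg, ht]
    have hid : Finsupp.lmapDomain R R p ∘ₗ linearSection hp = .id :=
      LinearMap.ext (map_linearSection hp)
    rw [wedgeInduced_comp (hc := fun a => by rw [hid]; exact ⟨a, rfl⟩)]
    have : ∀ (ψ : (A →₀ R) →ₗ[R] (A →₀ R)) (hψ), ψ = .id →
        wedgeInduced (augKer A) (augKer A) ψ hψ k = k := by
      rintro _ hψ rfl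
      exact wedgeInduced_id _ hψ k
    exact this _ _ hid
  · rintro ⟨z, hz, rfl⟩
    -- `R[B] → R[A] → B` differs from the augmentation `R[B] → B`, which vanishes on `y₁ - y₀`,
    -- by a map `δ` with values in `I`
    set δ : (B →₀ R) →ₗ[R] B := coverLift hp ∘ₗ Finsupp.lmapDomain R R p - aug B with hδ
    have hδj : ∀ y, δ y ∈ LinearMap.range j := fun y => (hex _).1 (by
      rw [hδ, LinearMap.sub_apply, map_sub, LinearMap.comp_apply, map_coverLift, aug_mapDomain,
        sub_self])
    obtain ⟨H, hH⟩ := exists_wedge_homotopy (augKer_exact A) (aug_surjective A) j (coverLift hp)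
      (lift_augKer_mem hex (map_coverLift hp)) δ hδj
    have key : wedgeInduced (augKer A) j (coverLift hp)
          (lift_augKer_mem hex (map_coverLift hp)) ∘ₗ tensorToWedge (augKer A) ∘ₗ
          tensorCycleMap p =
        -(H ∘ₗ TensorProduct.map (aug A ∘ₗ entry 0) (entry 0) ∘ₗ D0 A B) := by
      apply TensorProduct.ext'
      intro x y
      have h0 : ∀ i : Fin 2, coverLift hp (entry i (fibrePowerMap p (Fin 2) y)) =
          δ (entry i y) + aug B (entry i y) := by
        intro i
        rw [hδ, LinearMap.sub_apply, sub_add_cancel]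
        rfl
      have h1 : coverLift hp (entryDiff A (fibrePowerMap p (Fin 2) y)) =
          δ (entry 1 y) - δ (entry 0 y) := by
        rw [entryDiff, LinearMap.sub_apply, map_sub, h0, h0, aug_entry y 1 0]
        abel
      have e : ∀ i : Fin 2, TensorProduct.map (aug A ∘ₗ entry 0) (entry 0)
          (reindex A ![i] x ⊗ₜ[R] reindex B ![i] y) = aug A (entry 0 x) ⊗ₜ entry i y := by
        intro i
        rw [TensorProduct.map_tmul]
        change aug A (entry i x) ⊗ₜ entry i y = _
        rw [aug_entry x i 0]
      simp only [LinearMap.comp_apply, LinearMap.neg_apply, tensorCycleMap_tmul,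
        wedgeInduced_apply, TensorProduct.map_tmul, h1, D0_tmul, map_sub, e, hH]
      rw [tensorToWedge_swap]
      simp only [TensorProduct.tmul_sub, map_sub]
    have h := LinearMap.congr_fun key z
    rw [LinearMap.neg_apply, LinearMap.comp_apply, LinearMap.comp_apply, LinearMap.comp_apply,
      LinearMap.comp_apply, hz, map_zero, map_zero, neg_zero] at h
    exact h

/-- The map to `Λ²(B)/Λ²(I)` is natural with respect to maps of extensions. -/
theorem homologyToWedgeQuot_naturality {I' : Type u} [AddCommGroup I'] [Module R I']
    {A B A' B' : ModuleCat.{u} R} {p : B ⟶ A} {j : I →ₗ[R] B}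
    (hex : Function.Exact j p) (hp : Function.Surjective p) {p' : B' ⟶ A'} {j' : I' →ₗ[R] B'}
    (hex' : Function.Exact j' p') (hp' : Function.Surjective p') (g : B ⟶ B') (f : A ⟶ A')
    (hgf : ∀ x, p' (g x) = f (p x)) (hg : ∀ a, g.hom (j a) ∈ LinearMap.range j')
    (x : (symComplex A).homology 1) :
    homologyToWedgeQuot hex' hp' (symHomologyMap f x) =
      wedgeInduced j j' g.hom hg (homologyToWedgeQuot hex hp x) := by
  rw [homologyToWedgeQuot, homologyToWedgeQuot, LinearMap.comp_apply, LinearMap.comp_apply,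
    homologyToWedge_naturality]
  have hk : homologyToWedge A x ∈ augWedgeKer A := by
    rw [← range_homologyToWedge]
    exact ⟨x, rfl⟩
  have h1 : ∀ y, p' (coverLift hp' (Finsupp.lmapDomain R R f y)) = f (aug A y) := fun y => by
    rw [map_coverLift, aug_mapDomain]
  have h2 : ∀ y, p' (g (coverLift hp y)) = f (aug A y) := fun y => by
    rw [hgf, map_coverLift]
  have h0 : ∀ a, f (aug A (augKer A a)) = 0 := fun a => by
    rw [mem_range_augKer.1 ⟨a, rfl⟩, map_zero]
  rw [wedgeInduced_comp (hc := fun a => (hex' _).1 ((h1 (augKer A a)).trans (h0 a))),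
    wedgeInduced_comp (hc := fun a => (hex' _).1 ((h2 (augKer A a)).trans (h0 a)))]
  refine wedgeInduced_eq_of_sub_mem (aug_comp_augKer A) (augKer_exact A) (aug_surjective A)
    j' _ _ _ _ (fun y => (hex' _).1 ?_) hk
  rw [LinearMap.sub_apply, map_sub, sub_eq_zero]
  exact (h1 y).trans (h2 y).symm

end FirstDerived

section Tor

variable {R : Type} [CommRing R]

/-! ### The image of `Tor` -/

/-- Functoriality of the degreewise tensor product in the second variable. -/
def degreewiseTensorMap (X : SimplicialObject (ModuleCat.{u} R))
    {Y Y' : SimplicialObject (ModuleCat.{u} R)} (f : Y ⟶ Y') :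
    degreewiseTensor X Y ⟶ degreewiseTensor X Y' where
  app Δ := ModuleCat.ofHom ((f.app Δ).hom.lTensor (X.obj Δ))
  naturality Δ Δ' θ := by
    apply ModuleCat.hom_ext
    apply TensorProduct.ext'
    intro x y
    change (X.map θ) x ⊗ₜ (f.app Δ') (Y.map θ y) = (X.map θ) x ⊗ₜ (Y'.map θ) (f.app Δ y)
    congr 1
    exact ConcreteCategory.congr_hom (f.naturality θ) y

/-- The chain map `X(A) ⊗ X(B) → X(A) ⊗ X(B')` induced by `p : B → B'`. -/
abbrev tensorComplexMap (A : ModuleCat.{u} R) {B B' : ModuleCat.{u} R} (p : B ⟶ B') :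
    tensorComplex A B ⟶ tensorComplex A B' :=
  (AlgebraicTopology.alternatingFaceMapComplex _).map
    (degreewiseTensorMap (cechNerve.obj A) (cechNerve.map p))

/-- The chain map `cechComplex B → cechComplex B'` induced by `p : B → B'`. -/
abbrev cechComplexMap {B B' : ModuleCat.{u} R} (p : B ⟶ B') : cechComplex B ⟶ cechComplex B' :=
  (AlgebraicTopology.alternatingFaceMapComplex _).map (cechNerve.map p)

theorem augTensor_naturality (A : ModuleCat.{u} R) {B B' : ModuleCat.{u} R} (p : B ⟶ B') :
    augTensor A B ≫ ((tensorFunctor A).mapHomologicalComplex _).map (cechComplexMap p) =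
      tensorComplexMap A p ≫ augTensor A B' := by
  ext n : 1
  apply ModuleCat.hom_ext
  apply TensorProduct.ext'
  intro x y
  rfl

theorem cechComplexMap_cechπ {B B' : ModuleCat.{u} R} (p : B ⟶ B') :
    (cechComplexMap p).f 0 ≫ (cechπ B').f 0 = (cechπ B).f 0 ≫ p := by
  apply ModuleCat.hom_ext
  refine LinearMap.ext fun x => ?_
  exact aug_mapDomain p (entry 0 x)

/-- The class in `H₁(X(A) ⊗ X(B))` of a cycle. -/
def tensorClass (A B : ModuleCat.{u} R) :
    LinearMap.ker (D0 A B) →ₗ[R] (tensorComplex A B).homology 1 :=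
  cycleClass (tensorComplex A B) ∘ₗ Submodule.inclusion (by
    rw [oneCycles, tensorComplex_d]
    exact le_rfl)

theorem tensorClass_surjective (A B : ModuleCat.{u} R) : Function.Surjective (tensorClass A B) := by
  intro x
  obtain ⟨⟨c, hc⟩, rfl⟩ := cycleClass_surjective _ x
  refine ⟨⟨c, ?_⟩, rfl⟩
  rw [LinearMap.mem_ker, tensorComplex_d] at hc
  exact hc

/-- The chain map `X(A) ⊗ X(B) → X(A) ⊗ X(A) → SP²(X(A))` induced by `p : B → A`. -/
abbrev tensorToSymComplex {A B : ModuleCat.{u} R} (p : B ⟶ A) : tensorComplex A B ⟶ symComplex A :=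
  tensorComplexMap A p ≫ (AlgebraicTopology.alternatingFaceMapComplex _).map
    (degreewiseTensorToSym (cechNerve.obj A))

theorem tensorToSym_mem_ker_symD {A B : ModuleCat.{u} R} (p : B ⟶ A) {z : XX A B 2}
    (hz : D0 A B z = 0) :
    tensorToSym R _ ((fibrePowerMap p (Fin 2)).lTensor _ z) ∈ LinearMap.ker (symD A 0) := by
  have h : D0 A A ∘ₗ (fibrePowerMap p (Fin 2)).lTensor _ =
      (fibrePowerMap p (Fin 1)).lTensor _ ∘ₗ D0 A B := by
    apply TensorProduct.ext'
    intro x y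
    simp only [LinearMap.comp_apply, LinearMap.lTensor_tmul, D0_tmul, map_sub]
    rfl
  have h' := LinearMap.congr_fun h z
  rw [LinearMap.comp_apply, LinearMap.comp_apply, hz, map_zero] at h'
  rw [LinearMap.mem_ker, symD_tensorToSym]
  exact (congrArg (tensorToSym R _) h').trans (map_zero _)

theorem homologyToWedge_tensorClass {A B : ModuleCat.{u} R} (p : B ⟶ A)
    (z : LinearMap.ker (D0 A B)) :
    homologyToWedge A (HomologicalComplex.homologyMap (tensorToSymComplex p) 1
        (tensorClass A B z)) =
      tensorToWedge (augKer A) (tensorCycleMap p z.1) := by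
  have h : HomologicalComplex.homologyMap (tensorToSymComplex p) 1 (tensorClass A B z) =
      symClass A ⟨_, tensorToSym_mem_ker_symD p z.2⟩ :=
    homologyMap_cycleClass _ _ _ rfl
  rw [h, homologyToWedge_symClass, cycleToWedge_eq_iff]
  exact wedgeToKoszul_tensorCycle p z.1 z.2

/-- Naturality of the identification of `H₁(X(A) ⊗ X(B))` with `Tor(A, B)`. -/
theorem torIso_naturality (A : ModuleCat.{u} ℤ) {B B' : ModuleCat.{u} ℤ} (p : B ⟶ B') :
    (torIso A B).hom ≫ (tor A).map p =
      HomologicalComplex.homologyMap (tensorComplexMap A p) 1 ≫ (torIso A B').hom := by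
  have h := ProjectiveResolution.isoLeftDerivedObj_inv_naturality p (cechResolution B)
    (cechResolution B') (cechComplexMap p) (cechComplexMap_cechπ p) (tensorFunctor A) 1
  have h' := congrArg (fun f => HomologicalComplex.homologyMap f 1) (augTensor_naturality A p)
  simp only [HomologicalComplex.homologyMap_comp] at h'
  change (HomologicalComplex.homologyMap (augTensor A B) 1 ≫
      ((cechResolution B).isoLeftDerivedObj (tensorFunctor A) 1).inv) ≫
      ((tensorFunctor A).leftDerived 1).map p =
    HomologicalComplex.homologyMap (tensorComplexMap A p) 1 ≫
      HomologicalComplex.homologyMap (augTensor A B') 1 ≫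
      ((cechResolution B').isoLeftDerivedObj (tensorFunctor A) 1).inv
  exact (Category.assoc _ _ _).trans ((congrArg (_ ≫ ·) h).trans
    ((Category.assoc _ _ _).symm.trans ((congrArg (· ≫ _) h').trans (Category.assoc _ _ _))))

/-- The image of `Tor(A, B) → Tor(A, A) → L₁SP²(A)` consists of the classes of the images of cycles
of `X(A) ⊗ X(B)`. -/
theorem mem_range_tor_iff {A B : ModuleCat.{u} ℤ} (p : B ⟶ A) (x : (symComplex A).homology 1) :
    x ∈ LinearMap.range ((tor A).map p ≫ torToL1SP2 A).hom ↔
      ∃ z : XX A B 2, D0 A B z = 0 ∧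
        tensorToWedge (augKer A) (tensorCycleMap p z) = homologyToWedge A x := by
  have hmap : (torIso A B).hom ≫ (tor A).map p ≫ torToL1SP2 A =
      HomologicalComplex.homologyMap (tensorToSymComplex p) 1 :=
    (Category.assoc _ _ _).symm.trans ((congrArg (· ≫ torToL1SP2 A)
      (torIso_naturality A p)).trans ((Category.assoc _ _ _).trans ((congrArg (_ ≫ ·)
      (Iso.hom_inv_id_assoc (torIso A A) _)).trans
      (HomologicalComplex.homologyMap_comp _ _ _).symm)))
  have himg : ∀ h, ((tor A).map p ≫ torToL1SP2 A) ((torIso A B).hom h) =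
      HomologicalComplex.homologyMap (tensorToSymComplex p) 1 h :=
    ConcreteCategory.congr_hom hmap
  constructor
  · rintro ⟨y, rfl⟩
    obtain ⟨h, rfl⟩ : ∃ h, (torIso A B).hom h = y :=
      ⟨(torIso A B).inv y, ConcreteCategory.congr_hom (torIso A B).inv_hom_id y⟩
    obtain ⟨z, rfl⟩ := tensorClass_surjective A B h
    refine ⟨z.1, z.2, ?_⟩
    rw [← homologyToWedge_tensorClass]
    exact congrArg (homologyToWedge A) (himg _).symm
  · rintro ⟨z, hz, hzx⟩
    refine ⟨(torIso A B).hom (tensorClass A B ⟨z, hz⟩), (himg _).trans ?_⟩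
    apply homologyToWedge_injective
    rw [← hzx]
    exact homologyToWedge_tensorClass p ⟨z, hz⟩

theorem ker_homologyToWedgeQuot {I : Type u} [AddCommGroup I] [Module ℤ I]
    {A B : ModuleCat.{u} ℤ} {p : B ⟶ A} {j : I →ₗ[ℤ] B}
    (hex : Function.Exact j p) (hp : Function.Surjective p) :
    LinearMap.ker (homologyToWedgeQuot hex hp) =
      LinearMap.range ((tor A).map p ≫ torToL1SP2 A).hom := by
  ext x
  have hk : homologyToWedge A x ∈ augWedgeKer A := by
    rw [← range_homologyToWedge]
    exact ⟨x, rfl⟩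
  exact (wedgeInduced_coverLift_eq_zero_iff hex hp hk).trans (mem_range_tor_iff p x).symm

end Tor

section Pairs

variable {E E' : Type u} [AddCommGroup E] [AddCommGroup E']

/-! ### The isomorphism -/

theorem proj_surjective (I : AddSubgroup E) : Function.Surjective (proj I) :=
  QuotientAddGroup.mk'_surjective I

theorem incl_exact_proj (I : AddSubgroup E) : Function.Exact (incl I) (proj I) := fun x =>
  (QuotientAddGroup.eq_zero_iff x).trans ⟨fun h => ⟨⟨x, h⟩, rfl⟩, fun ⟨y, hy⟩ => hy ▸ y.2⟩

/-- The map `L₁SP²(E/I) → Λ²(E)/Λ²(I)`. -/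
def pairMap (I : AddSubgroup E) :
    L1SP2.obj (ModuleCat.of ℤ (E ⧸ I)) →ₗ[ℤ] WedgeQuot (incl I) :=
  homologyToWedgeQuot (B := ModuleCat.of ℤ E) (p := ModuleCat.ofHom (proj I))
    (incl_exact_proj I) (proj_surjective I)

theorem ker_pairMap (I : AddSubgroup E) :
    LinearMap.ker (pairMap I) = LinearMap.range (torMap I).hom :=
  ker_homologyToWedgeQuot (B := ModuleCat.of ℤ E) (p := ModuleCat.ofHom (proj I))
    (incl_exact_proj I) (proj_surjective I)

theorem range_pairMap (I : AddSubgroup E) : LinearMap.range (pairMap I) = WedgeKer I :=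
  range_homologyToWedgeQuot (B := ModuleCat.of ℤ E) (p := ModuleCat.ofHom (proj I))
    (incl_exact_proj I) (proj_surjective I)

/-- The isomorphism `Coker (Tor(E/I, E) → L₁SP²(E/I)) ≅ Ker (Λ²(E)/Λ²(I) → E/I ⊗ E)`. -/
def pairIso (I : AddSubgroup E) : TorCoker I ≃+ WedgeKer I :=
  quotEquivOfKerRange (pairMap I) (ker_pairMap I) (range_pairMap I)

theorem pairIso_apply (I : AddSubgroup E) (x : L1SP2.obj (ModuleCat.of ℤ (E ⧸ I))) :
    (pairIso I (toTorCoker I x) : WedgeQuot (incl I)) = pairMap I x :=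
  quotEquivOfKerRange_mkQ (pairMap I) (ker_pairMap I) (range_pairMap I) x

theorem pairMap_naturality {I : AddSubgroup E} {I' : AddSubgroup E'} (f : E →+ E')
    (hf : I ≤ I'.comap f) (x : L1SP2.obj (ModuleCat.of ℤ (E ⧸ I))) :
    pairMap I' (L1SP2Map f hf x) = wedgeMap f hf (pairMap I x) := by
  have hg : ∀ a, f.toIntLinearMap (incl I a) ∈ LinearMap.range (incl I') := fun a =>
    ⟨⟨f a, hf a.2⟩, rfl⟩
  refine (homologyToWedgeQuot_naturality (B := ModuleCat.of ℤ E) (B' := ModuleCat.of ℤ E')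
    (p := ModuleCat.ofHom (proj I)) (p' := ModuleCat.ofHom (proj I'))
    (incl_exact_proj I) (proj_surjective I) (incl_exact_proj I') (proj_surjective I')
    (ModuleCat.ofHom f.toIntLinearMap)
    (ModuleCat.ofHom (QuotientAddGroup.map I I' f hf).toIntLinearMap) (fun _ => rfl) hg x).trans ?_
  exact (wedgeQuotMap_eq_wedgeInduced ((f.comp I.subtype).codRestrict I'
    fun x => hf x.2).toIntLinearMap f.toIntLinearMap rfl hg _).symm

end Pairs

end QuadraticDerived

end

/-- There is an isomorphism `Coker (Tor(E/I, E) → L₁SP²(E/I)) ≅ Ker (Λ²(E)/image(Λ²(I)) → E/I ⊗ E)`,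
natural with respect to homomorphisms of pairs `f : (E, I) → (E', I')`. -/
theorem theorem3p2 :
    ∃ e : ∀ (E : Type u) [AddCommGroup E] (I : AddSubgroup E),
        QuadraticDerived.TorCoker I ≃+ QuadraticDerived.WedgeKer I,
      ∀ (E E' : Type u) [AddCommGroup E] [AddCommGroup E'] (I : AddSubgroup E)
        (I' : AddSubgroup E') (f : E →+ E') (hf : I ≤ I'.comap f)
        (x : QuadraticDerived.L1SP2.obj (ModuleCat.of ℤ (E ⧸ I))),
        (e E' I' (QuadraticDerived.toTorCoker I' (QuadraticDerived.L1SP2Map f hf x)) :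
            QuadraticDerived.WedgeQuot (QuadraticDerived.incl I')) =
          QuadraticDerived.wedgeMap f hf (e E I (QuadraticDerived.toTorCoker I x)) :=
  ⟨fun _ _ I => QuadraticDerived.pairIso I, fun _ _ _ _ I I' f hf x => by
    rw [QuadraticDerived.pairIso_apply, QuadraticDerived.pairIso_apply,
      QuadraticDerived.pairMap_naturality]⟩
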